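/- All rings are associative with $1$; let $R$ be a ring. For a left Gabriel filter $\mathcal F_l$ (of left ideals) and a right Gabriel filter $\mathcal F_r$ (of right ideals) of $R$, the induced symmetric filter ${}_l\mathcal F_r$ consists of the right ideals of $R\otimes_{\mathbb Z}R^{op}$ that contain $J\otimes R^{op}+R\otimes I$ (the sum of the images) for some $I\in\mathcal F_l$, $J\in\mathcal F_r$; it is a Gabriel filter. $R$-bimodules are regarded as right $R\otimes_{\mathbb Z} R^{op}$-modules via $x(s\otimes r)=rxs$; ${}_lt_r(M)$ is the torsion submodule, consisting of the $x$ whose annihilator lies in ${}_l\mathcal F_r$. The symmetric module of quotients of a bimodule $M$ is ${}_lM_r=\varinjlim_{K\in{}_l\mathcal F_r}\mathrm{Hom}(K,M/{}_lt_r(M))$, with canonical map $q:M\to{}_lM_r$; for $M=R$ it is a ring, the symmetric ring of quotients ${}_lR_r$. The symmetric torsion theory is called faithful if it is induced by faithful left and right theories (those for which $R$ is torsion-free as a left, respectively right, module). It is called differential if for every derivation $\delta$ of $R$ and every $K\in{}_l\mathcal F_r$ there is $L\in{}_l\mathcal F_r$ with $\bar\delta(L)\subseteq K$, where $\bar\delta(r\otimes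 s)=\delta(r)\otimes s+r\otimes\delta(s)$. Symmetric Lambek theory: $\mathcal F_l,\mathcal F_r$ are the filters of dense left and right ideals, and the ring of quotients is $Q^\sigma_{max}(R)$. Symmetric Goldie theory: induced by the left and right theories whose torsion-free modules are the nonsingular ones, with ring of quotients $Q^\sigma_{Gold}(R)$. A ring homomorphism $f:R\to S$ makes $S$ a perfect symmetric ring of quotients if $\mathcal F_l=\{I: Sf(I)=S\}$ and $\mathcal F_r=\{J: f(J)S=S\}$ are Gabriel filters and there is a ring isomorphism $S\cong{}_lR_r$ carrying $f$ to $q$; then ${}_l\mathcal F_r$ is called perfect. The total symmetric ring of quotients $Q^\sigma_{tot}(R)$ is the largest perfect symmetric ring of quotients containing $R$, i.e. the one whose filters $\mathcal F_l$, $\mathcal F_r$ are the largest among those of all faithful perfect symmetric theories; the corresponding theory is called the maximal perfect one. If $R$ is left and right Ore, the classical torsion theory is induced by the one-sided theories in which $x$ is torsion if and only if $tx=0$ (respectively $xt=0$) for some regular $t$; its symmetric ring of quotients is $Q_{cl}(R)$. Let $\delta$ be a derivation of $R$, $M$ an $R$-bimodule, and $d:M\to M$ a $\delta$-derivation, i.e.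 $d$ is additive with $d(rx)=\delta(r)x+r\,d(x)$ and $d(xr)=d(x)r+x\delta(r)$. An extension of $d$ to ${}_lM_r$ is a $\delta$-derivation $D$ of ${}_lM_r$ with $Dq=qd$; an extension of $\delta$ to ${}_lR_r$ is a ring derivation $D$ with $Dq=q\delta$. For two symmetric theories, we say that the extensions to the corresponding modules (or rings) of quotients agree if the first symmetric filter is contained in the second one, the extensions $D_1$ and $D_2$ to the first and second module (ring) of quotients both exist and are unique, and $q_{12}D_1=D_2q_{12}$ for the canonical map $q_{12}$ from the first module (ring) of quotients to the second one. Then $Q^\sigma_{tot}(R)$ exists, and: 1. The extension of $\delta$ to the symmetric ring of quotients of any faithful symmetric torsion theory agrees with the extension to $Q^\sigma_{max}(R)$. In particular, the extensions to $Q^\sigma_{tot}(R)$ and $Q^\sigma_{max}(R)$ agree. 2. The extension of $d$ to the symmetric module of quotients of $M$ for any differential faithful symmetric torsion theory agrees with the extension to the one for the symmetric Lambek theory. In particular, the extensions for the maximal perfect symmetric theory and the symmetric Lambek theory agree. 3. If $R$ is left and right Ore, then $Q_{cl}(R)$ is isomorphic, as a ring under $R$, to the Ore localization of $R$ at its regular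 elements, and the extension of $\delta$ to $Q_{cl}(R)$ agrees with the extensions to $Q^\sigma_{max}(R)$ and to $Q^\sigma_{tot}(R)$. 4. The extensions of $\delta$ to $Q^\sigma_{max}(R)$ and $Q^\sigma_{Gold}(R)$ agree. Moreover, the extension of $\delta$ to the symmetric ring of quotients of any faithful symmetric torsion theory agrees with the extension to $Q^\sigma_{Gold}(R)$. -/

import Mathlib

open scoped TensorProduct nonZeroDivisors
open MulOpposite

universe u v w

noncomputable section

/-! ### Gabriel filters

All ideals and modules are left ones. Right `R`-modules are treated, as everywhere in Mathlib, as
(left) modules over `Rᵐᵒᵖ`, so that right ideals of `R` are the elements of `Ideal Rᵐᵒᵖ`. -/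

/-- The left ideal `(I : a) = {b | b * a ∈ I}`. -/
def leftColon {A : Type u} [Ring A] (I : Ideal A) (a : A) : Ideal A :=
  Submodule.comap (LinearMap.toSpanSingleton A A a) I

@[simp] theorem mem_leftColon {A : Type u} [Ring A] {I : Ideal A} {a b : A} :
    b ∈ leftColon I a ↔ b * a ∈ I := by
  simp [leftColon]

/-- The annihilator `{a | a • x = 0}` of an element of a module. -/
def elemAnn (A : Type u) [Ring A] {M : Type v} [AddCommGroup M] [Module A M] (x : M) : Ideal A :=
  LinearMap.ker (LinearMap.toSpanSingleton A M x)

@[simp] theorem mem_elemAnn {A : Type u} [Ring A] {M : Type v} [AddCommGroup M] [Module A M]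
    {x : M} {a : A} : a ∈ elemAnn A x ↔ a • x = 0 := by
  simp [elemAnn]

/-- A Gabriel filter of left ideals of a ring; these are the filters that determine the hereditary
torsion theories of `A`-modules. -/
@[ext] structure GabrielFilter (A : Type u) [Ring A] where
  ideals : Set (Ideal A)
  top_mem : ⊤ ∈ ideals
  mem_of_le : ∀ {I J : Ideal A}, I ∈ ideals → I ≤ J → J ∈ ideals
  inf_mem : ∀ {I J : Ideal A}, I ∈ ideals → J ∈ ideals → I ⊓ J ∈ ideals
  colon_mem : ∀ {I : Ideal A}, I ∈ ideals → ∀ a : A, leftColon I a ∈ ideals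
  mem_of_colon : ∀ {I J : Ideal A}, J ∈ ideals → (∀ a ∈ J, leftColon I a ∈ ideals) → I ∈ ideals

namespace GabrielFilter

variable {A : Type u} [Ring A]

instance : Membership (Ideal A) (GabrielFilter A) := ⟨fun F I => I ∈ F.ideals⟩

instance : LE (GabrielFilter A) := ⟨fun F G => ∀ I : Ideal A, I ∈ F → I ∈ G⟩

/-- The torsion submodule `t(M)`: all `x` whose annihilator belongs to the filter. -/
def torsion (F : GabrielFilter A) (M : Type v) [AddCommGroup M] [Module A M] : Submodule A M where
  carrier := {x | elemAnn A x ∈ F}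
  zero_mem' := F.mem_of_le F.top_mem (fun a _ => by simp)
  add_mem' := fun {x y} hx hy => F.mem_of_le (F.inf_mem hx hy) (fun a ha => by
    obtain ⟨h1, h2⟩ := ha
    have h1' := mem_elemAnn.1 h1
    have h2' := mem_elemAnn.1 h2
    simp [h1', h2'])
  smul_mem' := fun c x hx => F.mem_of_le (F.colon_mem hx c) (fun a ha => by
    simpa [mul_smul] using ha)

theorem mem_torsion {F : GabrielFilter A} {M : Type v} [AddCommGroup M] [Module A M] {x : M} :
    x ∈ F.torsion M ↔ elemAnn A x ∈ F := Iff.rfl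

/-- The torsion theory is faithful: `t(A) = 0`. -/
def IsFaithful (F : GabrielFilter A) : Prop := F.torsion A = ⊥

/-- The torsion-free quotient `M / t(M)`. -/
abbrev TFQuot (F : GabrielFilter A) (M : Type v) [AddCommGroup M] [Module A M] : Type v :=
  M ⧸ F.torsion M

theorem tfQuot_eq_zero {F : GabrielFilter A} {M : Type v} [AddCommGroup M] [Module A M]
    {x : F.TFQuot M} {K : Ideal A} (hK : K ∈ F) (h : ∀ k ∈ K, k • x = 0) : x = 0 := by
  obtain ⟨m, rfl⟩ := Submodule.Quotient.mk_surjective _ x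
  rw [Submodule.Quotient.mk_eq_zero, mem_torsion]
  refine F.mem_of_colon hK (fun k hk => ?_)
  have := h k hk
  rw [← Submodule.Quotient.mk_smul, Submodule.Quotient.mk_eq_zero, mem_torsion] at this
  refine F.mem_of_le this (fun a ha => ?_)
  simpa [mul_smul] using ha

/-! ### Modules of quotients -/

/-- The filter as an index set for direct limits (smaller ideals are larger indices). -/
structure Index (F : GabrielFilter A) : Type u where
  ideal : Ideal A
  mem : ideal ∈ F

instance (F : GabrielFilter A) : Preorder F.Index where
  le K L := L.ideal ≤ K.ideal
  le_refl _ := le_rfl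
  le_trans _ _ _ h h' := h'.trans h

/-- The index belonging to an ideal of the filter. -/
abbrev idx (F : GabrielFilter A) (K : Ideal A) (hK : K ∈ F) : F.Index := ⟨K, hK⟩

instance (F : GabrielFilter A) : Nonempty F.Index := ⟨F.idx ⊤ F.top_mem⟩

instance (F : GabrielFilter A) : IsDirectedOrder F.Index :=
  ⟨fun K L => ⟨F.idx (K.ideal ⊓ L.ideal) (F.inf_mem K.mem L.mem),
    show K.ideal ⊓ L.ideal ≤ K.ideal from inf_le_left,
    show K.ideal ⊓ L.ideal ≤ L.ideal from inf_le_right⟩⟩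

section

variable (F : GabrielFilter A) (M : Type v) [AddCommGroup M] [Module A M]

/-- `Hom(K, M / t(M))` for `K` in the filter. -/
abbrev HomTF (K : F.Index) : Type (max u v) := K.ideal →ₗ[A] F.TFQuot M

/-- Restriction `Hom(K, M / t(M)) → Hom(L, M / t(M))` for `L ⊆ K`. -/
def restr (K L : F.Index) (h : K ≤ L) : F.HomTF M K →+ F.HomTF M L where
  toFun φ := φ ∘ₗ Submodule.inclusion (show L.ideal ≤ K.ideal from h)
  map_zero' := rfl
  map_add' _ _ := rfl

instance : DirectedSystem (F.HomTF M) (fun K L h => F.restr M K L h) where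
  map_self _ _ := rfl
  map_map _ _ _ _ _ _ := rfl

open Classical in
/-- The module of quotients: the direct limit of `Hom(K, M / t(M))` over all `K` in the filter. -/
def ModQ : Type (max u v) := AddCommGroup.DirectLimit (F.HomTF M) (F.restr M)

open Classical in
instance : AddCommGroup (F.ModQ M) :=
  inferInstanceAs (AddCommGroup (AddCommGroup.DirectLimit (F.HomTF M) (F.restr M)))

open Classical in
/-- The class in the module of quotients of a homomorphism `φ : K → M / t(M)`. -/
def germ (K : F.Index) : F.HomTF M K →+ F.ModQ M :=
  AddCommGroup.DirectLimit.of (F.HomTF M) (F.restr M) K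

end

section

variable {F : GabrielFilter A} {M : Type v} [AddCommGroup M] [Module A M]

theorem exists_germ (x : F.ModQ M) : ∃ (K : F.Index) (φ : F.HomTF M K), F.germ M K φ = x := by
  classical
  exact AddCommGroup.DirectLimit.induction_on
    (C := fun x : F.ModQ M => ∃ (K : F.Index) (φ : F.HomTF M K), F.germ M K φ = x)
    x (fun K φ => ⟨K, φ, rfl⟩)

theorem germ_restr (K L : F.Index) (h : K ≤ L) (φ : F.HomTF M K) :
    F.germ M L (F.restr M K L h φ) = F.germ M K φ := by
  classical
  exact AddCommGroup.DirectLimit.of_f h φ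

/-- Homomorphisms that agree on an ideal in the filter have the same class. -/
theorem germ_eq (K L : F.Index) (φ : F.HomTF M K) (ψ : F.HomTF M L) (N : Ideal A) (hN : N ∈ F)
    (h : ∀ a ∈ N, ∀ (h1 : a ∈ K.ideal) (h2 : a ∈ L.ideal), φ ⟨a, h1⟩ = ψ ⟨a, h2⟩) :
    F.germ M K φ = F.germ M L ψ := by
  have hP : N ⊓ (K.ideal ⊓ L.ideal) ∈ F := F.inf_mem hN (F.inf_mem K.mem L.mem)
  set P := F.idx _ hP with hPdef
  have hK : K ≤ P := show N ⊓ (K.ideal ⊓ L.ideal) ≤ K.ideal from inf_le_right.trans inf_le_left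
  have hL : L ≤ P := show N ⊓ (K.ideal ⊓ L.ideal) ≤ L.ideal from inf_le_right.trans inf_le_right
  rw [← germ_restr K P hK, ← germ_restr L P hL]
  congr 1
  ext ⟨a, ha⟩
  exact h a ha.1 ha.2.1 ha.2.2

theorem germ_zero_exact (K : F.Index) (φ : F.HomTF M K) (h : F.germ M K φ = 0) : φ = 0 := by
  classical
  obtain ⟨L, hL, h0⟩ := AddCommGroup.DirectLimit.of.zero_exact K φ h
  ext ⟨a, ha⟩
  refine tfQuot_eq_zero (F.colon_mem L.mem a) (fun b hb => ?_)
  rw [← map_smul]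
  exact LinearMap.congr_fun h0 ⟨b * a, by simpa using hb⟩

end

section

variable (F : GabrielFilter A) (M : Type v) [AddCommGroup M] [Module A M]

/-- `(a • φ)(b) = φ (b * a)` for `φ : K → M / t(M)` and `b ∈ (K : a)`. -/
def smulHom (a : A) (K : F.Index) :
    F.HomTF M K →+ F.HomTF M (F.idx (leftColon K.ideal a) (F.colon_mem K.mem a)) where
  toFun φ := φ ∘ₗ ((LinearMap.toSpanSingleton A A a).restrict (fun _ hb => hb))
  map_zero' := rfl
  map_add' _ _ := rfl

theorem smulHom_apply (a : A) (K : F.Index) (φ : F.HomTF M K) (b : A) (h : b ∈ leftColon K.ideal a) :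
    F.smulHom M a K φ ⟨b, h⟩ = φ ⟨b * a, by simpa using h⟩ := rfl

open Classical in
/-- Multiplication by `a` on the module of quotients. -/
def smulQ (a : A) : F.ModQ M →+ F.ModQ M :=
  AddCommGroup.DirectLimit.lift (F.HomTF M) (F.restr M) (F.ModQ M)
    (fun K => (F.germ M _).comp (F.smulHom M a K))
    (fun K L h φ => by
      refine germ_eq _ _ _ _ ⊤ F.top_mem (fun b _ h1 h2 => ?_)
      rfl)

instance : SMul A (F.ModQ M) := ⟨fun a x => F.smulQ M a x⟩

theorem smul_germ (a : A) (K : F.Index) (φ : F.HomTF M K) :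
    a • F.germ M K φ = F.germ M _ (F.smulHom M a K φ) := by
  classical
  exact AddCommGroup.DirectLimit.lift_of _ _ _ K φ

instance : Module A (F.ModQ M) where
  one_smul x := by
    obtain ⟨K, φ, rfl⟩ := exists_germ x
    rw [smul_germ]
    refine germ_eq _ _ _ _ ⊤ F.top_mem (fun b _ h1 h2 => ?_)
    rw [smulHom_apply]
    simp
  mul_smul a b x := by
    obtain ⟨K, φ, rfl⟩ := exists_germ x
    rw [smul_germ, smul_germ, smul_germ]
    refine germ_eq _ _ _ _ ⊤ F.top_mem (fun c _ h1 h2 => ?_)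
    rw [smulHom_apply, smulHom_apply, smulHom_apply]
    simp [mul_assoc]
  smul_zero a := map_zero (F.smulQ M a)
  smul_add a := map_add (F.smulQ M a)
  add_smul a b x := by
    obtain ⟨K, φ, rfl⟩ := exists_germ x
    rw [smul_germ, smul_germ, smul_germ]
    set L := F.idx (leftColon K.ideal a ⊓ leftColon K.ideal b)
      (F.inf_mem (F.colon_mem K.mem a) (F.colon_mem K.mem b)) with hL
    rw [← germ_restr _ L (show leftColon K.ideal a ⊓ leftColon K.ideal b ≤ _ from inf_le_left)
        (F.smulHom M a K φ),
      ← germ_restr _ L (show leftColon K.ideal a ⊓ leftColon K.ideal b ≤ _ from inf_le_right)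
        (F.smulHom M b K φ), ← map_add]
    refine germ_eq _ _ _ _ ⊤ F.top_mem (fun c _ h1 h2 => ?_)
    rw [smulHom_apply]
    have e : (⟨c * (a + b), by simpa using h1⟩ : K.ideal) =
        ⟨c * a, by simpa using h2.1⟩ + ⟨c * b, by simpa using h2.2⟩ := by
      ext; simp [mul_add]
    rw [e, map_add]
    rfl
  zero_smul x := by
    obtain ⟨K, φ, rfl⟩ := exists_germ x
    rw [smul_germ, ← map_zero (F.germ M K)]
    refine germ_eq _ _ _ _ ⊤ F.top_mem (fun b _ h1 h2 => ?_)
    rw [smulHom_apply]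
    have e : (⟨b * 0, by simp⟩ : K.ideal) = 0 := by ext; simp
    rw [e, map_zero]
    rfl

/-- The canonical map `q : M → M_F`, sending `m` to the class of `a ↦ a • m + t(M)`. -/
def toModQ : M →ₗ[A] F.ModQ M where
  toFun m := F.germ M (F.idx ⊤ F.top_mem)
    (LinearMap.toSpanSingleton A (F.TFQuot M) (Submodule.Quotient.mk m) ∘ₗ Submodule.subtype _)
  map_add' m n := by
    rw [← map_add]
    congr 1
    ext a
    simp
  map_smul' a m := by
    rw [RingHom.id_apply, smul_germ]
    refine germ_eq _ _ _ _ ⊤ F.top_mem (fun b _ h1 h2 => ?_)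
    rw [smulHom_apply]
    simp [mul_smul]

end

section

variable {F : GabrielFilter A} {M : Type v} [AddCommGroup M] [Module A M]

theorem smul_germ_of_mem (K : F.Index) (φ : F.HomTF M K) (k : A) (hk : k ∈ K.ideal) (m : M)
    (hm : φ ⟨k, hk⟩ = Submodule.Quotient.mk m) : k • F.germ M K φ = F.toModQ M m := by
  rw [smul_germ]
  refine germ_eq _ _ _ _ ⊤ F.top_mem (fun b _ h1 h2 => ?_)
  rw [smulHom_apply]
  have e : (⟨b * k, by simpa using h1⟩ : K.ideal) = b • ⟨k, hk⟩ := rfl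
  rw [e, map_smul, hm]
  rfl

theorem toModQ_eq_zero_iff (m : M) : F.toModQ M m = 0 ↔ m ∈ F.torsion M := by
  constructor
  · intro h
    have := germ_zero_exact _ _ h
    have h1 := LinearMap.congr_fun this ⟨1, trivial⟩
    simpa using h1
  · intro h
    have h0 : (Submodule.Quotient.mk m : F.TFQuot M) = 0 :=
      (Submodule.Quotient.mk_eq_zero _).2 h
    change F.germ M _ _ = 0
    rw [h0]
    simp

/-- Every element of the module of quotients is moved into the image of `M` by an ideal of the
filter. -/
theorem exists_smul_mem (x : F.ModQ M) : ∃ K ∈ F, ∀ k ∈ K, ∃ m, k • x = F.toModQ M m := by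
  obtain ⟨K, φ, rfl⟩ := exists_germ x
  refine ⟨K.ideal, K.mem, fun k hk => ?_⟩
  obtain ⟨m, hm⟩ := Submodule.Quotient.mk_surjective _ (φ ⟨k, hk⟩)
  exact ⟨m, smul_germ_of_mem K φ k hk m hm.symm⟩

/-- The module of quotients is torsion-free. -/
theorem modQ_eq_zero {x : F.ModQ M} {K : Ideal A} (hK : K ∈ F) (h : ∀ k ∈ K, k • x = 0) :
    x = 0 := by
  obtain ⟨L, φ, rfl⟩ := exists_germ x
  rw [← map_zero (F.germ M L)]
  refine germ_eq _ _ _ _ K hK (fun a ha h1 h2 => ?_)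
  obtain ⟨m, hm⟩ := Submodule.Quotient.mk_surjective _ (φ ⟨a, h1⟩)
  have := smul_germ_of_mem L φ a h1 m hm.symm
  rw [h a ha] at this
  rw [← hm, LinearMap.zero_apply, Submodule.Quotient.mk_eq_zero]
  exact (toModQ_eq_zero_iff m).1 this.symm

theorem modQ_ext {x y : F.ModQ M} {K : Ideal A} (hK : K ∈ F) (h : ∀ k ∈ K, k • x = k • y) :
    x = y :=
  sub_eq_zero.1 (modQ_eq_zero hK (fun k hk => by rw [smul_sub, h k hk, sub_self]))

/-- A single-valued submodule of `A × M_F` whose domain contains an ideal of the filter is given by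
an element of `M_F`. -/
theorem exists_of_graph (Γ : Submodule A (A × F.ModQ M)) (hΓ : ∀ n, (0, n) ∈ Γ → n = 0)
    (K : Ideal A) (hK : K ∈ F) (hKΓ : ∀ k ∈ K, ∃ n, (k, n) ∈ Γ) :
    ∃ x : F.ModQ M, ∀ a n, (a, n) ∈ Γ → a • x = n := by
  have huniq : ∀ a n n', (a, n) ∈ Γ → (a, n') ∈ Γ → n = n' := by
    intro a n n' h h'
    have := Γ.sub_mem h h'
    rw [Prod.mk_sub_mk, sub_self] at this
    exact sub_eq_zero.1 (hΓ _ this)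
  let L : Ideal A :=
    { carrier := {a | ∃ m, (a, F.toModQ M m) ∈ Γ}
      zero_mem' := ⟨0, by rw [map_zero]; exact Γ.zero_mem⟩
      add_mem' := by
        rintro a b ⟨m, hm⟩ ⟨n, hn⟩
        exact ⟨m + n, by rw [map_add]; exact Γ.add_mem hm hn⟩
      smul_mem' := by
        rintro c a ⟨m, hm⟩
        exact ⟨c • m, by rw [map_smul]; exact Γ.smul_mem c hm⟩ }
  have hL : L ∈ F := by
    refine F.mem_of_colon hK (fun k hk => ?_)
    obtain ⟨n, hn⟩ := hKΓ k hk
    obtain ⟨N, hN, h⟩ := exists_smul_mem n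
    refine F.mem_of_le hN (fun b hb => ?_)
    obtain ⟨m, hm⟩ := h b hb
    rw [mem_leftColon]
    refine ⟨m, ?_⟩
    rw [← hm]
    exact Γ.smul_mem b hn
  have hq : ∀ m m', F.toModQ M m = F.toModQ M m' →
      (Submodule.Quotient.mk m : F.TFQuot M) = Submodule.Quotient.mk m' := by
    intro m m' h
    rw [Submodule.Quotient.eq, ← toModQ_eq_zero_iff, map_sub, h, sub_self]
  choose m hm using fun a : L => a.2
  let φ : L →ₗ[A] F.TFQuot M :=
    { toFun := fun a => Submodule.Quotient.mk (m a)
      map_add' := fun a b => by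
        rw [← Submodule.Quotient.mk_add]
        refine hq _ _ (huniq _ _ _ (hm (a + b)) ?_)
        rw [map_add]
        exact Γ.add_mem (hm a) (hm b)
      map_smul' := fun c a => by
        rw [RingHom.id_apply, ← Submodule.Quotient.mk_smul]
        refine hq _ _ (huniq _ _ _ (hm (c • a)) ?_)
        rw [map_smul]
        exact Γ.smul_mem c (hm a) }
  refine ⟨F.germ M (F.idx L hL) φ, fun a n han => ?_⟩
  refine modQ_ext (F.colon_mem hL a) (fun b hb => ?_)
  have hb' : b * a ∈ L := by simpa using hb
  rw [← mul_smul, smul_germ_of_mem (F.idx L hL) φ (b * a) hb' (m ⟨b * a, hb'⟩) rfl]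
  exact huniq _ _ _ (hm ⟨b * a, hb'⟩) (Γ.smul_mem b han)

end

section

variable {F G : GabrielFilter A} (M : Type v) [AddCommGroup M] [Module A M]

/-- The projection `M / t_F(M) → M / t_G(M)` for `F ⊆ G`. -/
def tfQuotMap (h : F ≤ G) : F.TFQuot M →ₗ[A] G.TFQuot M :=
  Submodule.mapQ (F.torsion M) (G.torsion M) LinearMap.id (fun x hx => h (elemAnn A x) hx)

open Classical in
/-- The canonical map `M_F → M_G` for `F ⊆ G`, sending the class of `φ : K → M / t_F(M)` to the
class of `K → M / t_F(M) → M / t_G(M)`. -/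
def modQMap (h : F ≤ G) : F.ModQ M →+ G.ModQ M :=
  AddCommGroup.DirectLimit.lift (F.HomTF M) (F.restr M) (G.ModQ M)
    (fun K => (G.germ M (G.idx K.ideal (h _ K.mem))).comp
      { toFun := fun φ => tfQuotMap M h ∘ₗ φ
        map_zero' := LinearMap.comp_zero _
        map_add' := fun φ ψ => LinearMap.comp_add _ _ _ })
    (fun K L hKL φ => by
      refine germ_eq _ _ _ _ ⊤ G.top_mem (fun b _ h1 h2 => ?_)
      rfl)

end

end GabrielFilter

/-! ### Bimodules and symmetric filters

An `R`-bimodule is an abelian group with commuting actions of `R` and `Rᵐᵒᵖ`; the right action is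
`x r = op r • x`. It is the same as a module over `R ⊗ Rᵐᵒᵖ`, with `(r ⊗ op s) • x = r x s`. -/

/-- The enveloping ring `R ⊗_ℤ Rᵐᵒᵖ`. -/
abbrev Env (R : Type u) [Ring R] : Type u := R ⊗[ℤ] Rᵐᵒᵖ

/-- A copy of the bimodule `M`, considered as a module over the enveloping ring. -/
def EnvMod (R : Type u) (M : Type v) [Ring R] : Type v := M

section

variable (R : Type u) [Ring R] (M : Type v) [AddCommGroup M]

instance : AddCommGroup (EnvMod R M) := inferInstanceAs (AddCommGroup M)

variable [Module R M] [Module Rᵐᵒᵖ M] [SMulCommClass R Rᵐᵒᵖ M]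

instance : Module (Env R) (EnvMod R M) := TensorProduct.Algebra.module (R := ℤ) (M := M)

/-- The identity map from `M` to its copy. -/
def toEnvMod : M →+ EnvMod R M := AddMonoidHom.id M

theorem tmul_smul_toEnvMod (r : R) (s : Rᵐᵒᵖ) (x : M) :
    (r ⊗ₜ[ℤ] s : Env R) • toEnvMod R M x = toEnvMod R M (r • s • x) :=
  TensorProduct.Algebra.smul_def r s x

end

section

variable {R : Type u} [Ring R]

/-- For a left ideal `I` and a right ideal `J` the left ideal `I ⊗ Rᵐᵒᵖ + R ⊗ J` of `R ⊗ Rᵐᵒᵖ`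
(more precisely, the sum of the images), generated by all `i ⊗ 1` and `1 ⊗ j`. -/
def symIdeal (I : Ideal R) (J : Ideal Rᵐᵒᵖ) : Ideal (Env R) :=
  Ideal.span ((fun i : R => (i ⊗ₜ[ℤ] 1 : Env R)) '' I) ⊔
    Ideal.span ((fun j : Rᵐᵒᵖ => (1 ⊗ₜ[ℤ] j : Env R)) '' J)

theorem symIdeal_le {I : Ideal R} {J : Ideal Rᵐᵒᵖ} {K : Ideal (Env R)} :
    symIdeal I J ≤ K ↔ (∀ i ∈ I, (i ⊗ₜ[ℤ] 1 : Env R) ∈ K) ∧ ∀ j ∈ J, (1 ⊗ₜ[ℤ] j : Env R) ∈ K := by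
  simp [symIdeal, Ideal.span_le, Set.subset_def]

theorem tmul_one_mem {I : Ideal R} {J : Ideal Rᵐᵒᵖ} {i : R} (hi : i ∈ I) :
    (i ⊗ₜ[ℤ] 1 : Env R) ∈ symIdeal I J := (symIdeal_le.1 le_rfl).1 i hi

theorem one_tmul_mem {I : Ideal R} {J : Ideal Rᵐᵒᵖ} {j : Rᵐᵒᵖ} (hj : j ∈ J) :
    (1 ⊗ₜ[ℤ] j : Env R) ∈ symIdeal I J := (symIdeal_le.1 le_rfl).2 j hj

theorem tmul_mem_left {I : Ideal R} {J : Ideal Rᵐᵒᵖ} {i : R} (hi : i ∈ I) (s : Rᵐᵒᵖ) :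
    (i ⊗ₜ[ℤ] s : Env R) ∈ symIdeal I J := by
  have := (symIdeal I J).mul_mem_left (1 ⊗ₜ[ℤ] s : Env R) (tmul_one_mem hi)
  simpa [Algebra.TensorProduct.tmul_mul_tmul] using this

theorem tmul_mem_right {I : Ideal R} {J : Ideal Rᵐᵒᵖ} {j : Rᵐᵒᵖ} (hj : j ∈ J) (r : R) :
    (r ⊗ₜ[ℤ] j : Env R) ∈ symIdeal I J := by
  have := (symIdeal I J).mul_mem_left (r ⊗ₜ[ℤ] 1 : Env R) (one_tmul_mem hj)
  simpa [Algebra.TensorProduct.tmul_mul_tmul] using this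

/-- The symmetric filter induced by a left and a right Gabriel filter of `R`. -/
def symFilter (Fl : GabrielFilter R) (Fr : GabrielFilter Rᵐᵒᵖ) : GabrielFilter (Env R) where
  ideals := {K | ∃ I ∈ Fl, ∃ J ∈ Fr, symIdeal I J ≤ K}
  top_mem := ⟨⊤, Fl.top_mem, ⊤, Fr.top_mem, le_top⟩
  mem_of_le := by
    rintro K L ⟨I, hI, J, hJ, h⟩ hKL
    exact ⟨I, hI, J, hJ, h.trans hKL⟩
  inf_mem := by
    rintro K L ⟨I, hI, J, hJ, h⟩ ⟨I', hI', J', hJ', h'⟩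
    rw [symIdeal_le] at h h'
    refine ⟨I ⊓ I', Fl.inf_mem hI hI', J ⊓ J', Fr.inf_mem hJ hJ', symIdeal_le.2 ⟨?_, ?_⟩⟩
    · exact fun i hi => ⟨h.1 i hi.1, h'.1 i hi.2⟩
    · exact fun j hj => ⟨h.2 j hj.1, h'.2 j hj.2⟩
  colon_mem := by
    rintro K ⟨I, hI, J, hJ, h⟩ a
    induction a using TensorProduct.induction_on with
    | zero =>
      exact ⟨I, hI, J, hJ, fun b _ => by simp⟩
    | tmul r s =>
      refine ⟨leftColon I r, Fl.colon_mem hI r, leftColon J s, Fr.colon_mem hJ s,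
        symIdeal_le.2 ⟨fun i hi => ?_, fun j hj => ?_⟩⟩
      · rw [mem_leftColon, Algebra.TensorProduct.tmul_mul_tmul]
        exact h (tmul_mem_left (mem_leftColon.1 hi) _)
      · rw [mem_leftColon, Algebra.TensorProduct.tmul_mul_tmul]
        exact h (tmul_mem_right (mem_leftColon.1 hj) _)
    | add a b ha hb =>
      obtain ⟨I, hI, J, hJ, h⟩ := ha
      obtain ⟨I', hI', J', hJ', h'⟩ := hb
      rw [symIdeal_le] at h h'
      refine ⟨I ⊓ I', Fl.inf_mem hI hI', J ⊓ J', Fr.inf_mem hJ hJ', symIdeal_le.2 ⟨?_, ?_⟩⟩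
      · intro i hi
        rw [mem_leftColon, mul_add]
        exact K.add_mem (mem_leftColon.1 (h.1 i hi.1)) (mem_leftColon.1 (h'.1 i hi.2))
      · intro j hj
        rw [mem_leftColon, mul_add]
        exact K.add_mem (mem_leftColon.1 (h.2 j hj.1)) (mem_leftColon.1 (h'.2 j hj.2))
  mem_of_colon := by
    rintro K L ⟨I, hI, J, hJ, h⟩ hK
    let I' : Ideal R :=
      { carrier := {i | (i ⊗ₜ[ℤ] 1 : Env R) ∈ K}
        zero_mem' := by simp
        add_mem' := fun {a b} ha hb => by
          simpa [TensorProduct.add_tmul] using K.add_mem ha hb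
        smul_mem' := fun c a ha => by
          simpa [Algebra.TensorProduct.tmul_mul_tmul] using K.mul_mem_left (c ⊗ₜ[ℤ] 1) ha }
    let J' : Ideal Rᵐᵒᵖ :=
      { carrier := {j | (1 ⊗ₜ[ℤ] j : Env R) ∈ K}
        zero_mem' := by simp
        add_mem' := fun {a b} ha hb => by
          simpa [TensorProduct.tmul_add] using K.add_mem ha hb
        smul_mem' := fun c a ha => by
          simpa [Algebra.TensorProduct.tmul_mul_tmul] using K.mul_mem_left (1 ⊗ₜ[ℤ] c) ha }
    have hI' : I' ∈ Fl := by
      refine Fl.mem_of_colon hI (fun i hi => ?_)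
      obtain ⟨I₁, hI₁, J₁, hJ₁, h₁⟩ := hK _ (h (tmul_one_mem hi))
      refine Fl.mem_of_le hI₁ (fun b hb => ?_)
      have := h₁ (tmul_one_mem hb)
      rw [mem_leftColon, Algebra.TensorProduct.tmul_mul_tmul, one_mul] at this
      exact mem_leftColon.2 this
    have hJ' : J' ∈ Fr := by
      refine Fr.mem_of_colon hJ (fun j hj => ?_)
      obtain ⟨I₁, hI₁, J₁, hJ₁, h₁⟩ := hK _ (h (one_tmul_mem hj))
      refine Fr.mem_of_le hJ₁ (fun b hb => ?_)
      have := h₁ (one_tmul_mem hb)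
      rw [mem_leftColon, Algebra.TensorProduct.tmul_mul_tmul, one_mul] at this
      exact mem_leftColon.2 this
    exact ⟨I', hI', J', hJ', symIdeal_le.2 ⟨fun i hi => hi, fun j hj => hj⟩⟩

end

/-! ### Symmetric modules and rings of quotients -/

section

variable {R : Type u} [Ring R] (Fl : GabrielFilter R) (Fr : GabrielFilter Rᵐᵒᵖ)
variable (M : Type v) [AddCommGroup M] [Module R M] [Module Rᵐᵒᵖ M] [SMulCommClass R Rᵐᵒᵖ M]

/-- The symmetric module of quotients of a bimodule: the direct limit of the groups of bimodule
homomorphisms `Hom(K, M / t(M))` over all `K` in the symmetric filter. -/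
def SymQ : Type (max u v) := (symFilter Fl Fr).ModQ (EnvMod R M)

instance : AddCommGroup (SymQ Fl Fr M) :=
  inferInstanceAs (AddCommGroup ((symFilter Fl Fr).ModQ (EnvMod R M)))

instance : Module (Env R) (SymQ Fl Fr M) :=
  inferInstanceAs (Module (Env R) ((symFilter Fl Fr).ModQ (EnvMod R M)))

instance : Module R (SymQ Fl Fr M) :=
  Module.compHom _ (Algebra.TensorProduct.includeLeftRingHom : R →+* Env R)

instance : Module Rᵐᵒᵖ (SymQ Fl Fr M) :=
  Module.compHom _ ((Algebra.TensorProduct.includeRight : Rᵐᵒᵖ →ₐ[ℤ] Env R) : Rᵐᵒᵖ →+* Env R)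

variable {Fl Fr M} in
theorem left_smul_def (r : R) (x : SymQ Fl Fr M) : r • x = (r ⊗ₜ[ℤ] 1 : Env R) • x := rfl

variable {Fl Fr M} in
theorem right_smul_def (s : Rᵐᵒᵖ) (x : SymQ Fl Fr M) : s • x = (1 ⊗ₜ[ℤ] s : Env R) • x := rfl

variable {Fl Fr M} in
theorem tmul_smul_symQ (r : R) (s : Rᵐᵒᵖ) (x : SymQ Fl Fr M) :
    (r ⊗ₜ[ℤ] s : Env R) • x = r • s • x := by
  rw [left_smul_def, right_smul_def, ← mul_smul, Algebra.TensorProduct.tmul_mul_tmul, one_mul,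
    mul_one]

instance : SMulCommClass R Rᵐᵒᵖ (SymQ Fl Fr M) where
  smul_comm r s x := by
    rw [← tmul_smul_symQ, left_smul_def, right_smul_def, ← mul_smul,
      Algebra.TensorProduct.tmul_mul_tmul, one_mul, mul_one]

instance : SMulCommClass Rᵐᵒᵖ R (SymQ Fl Fr M) := SMulCommClass.symm _ _ _

/-- The canonical map `q : M → M_F` into the symmetric module of quotients. -/
def toSymQ : M →+ SymQ Fl Fr M :=
  ((symFilter Fl Fr).toModQ (EnvMod R M)).toAddMonoidHom.comp (toEnvMod R M)

variable {Fl Fr M}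

theorem toSymQ_left_smul (r : R) (m : M) : toSymQ Fl Fr M (r • m) = r • toSymQ Fl Fr M m := by
  have := ((symFilter Fl Fr).toModQ (EnvMod R M)).map_smul (r ⊗ₜ[ℤ] 1) (toEnvMod R M m)
  rw [tmul_smul_toEnvMod, one_smul] at this
  exact this

theorem toSymQ_right_smul (s : Rᵐᵒᵖ) (m : M) : toSymQ Fl Fr M (s • m) = s • toSymQ Fl Fr M m := by
  have := ((symFilter Fl Fr).toModQ (EnvMod R M)).map_smul (1 ⊗ₜ[ℤ] s) (toEnvMod R M m)
  rw [tmul_smul_toEnvMod, one_smul] at this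
  exact this

theorem exists_left_smul_mem (x : SymQ Fl Fr M) :
    ∃ I ∈ Fl, ∀ i ∈ I, ∃ m, i • x = toSymQ Fl Fr M m := by
  obtain ⟨K, ⟨I, hI, J, hJ, h⟩, hK⟩ := GabrielFilter.exists_smul_mem x
  exact ⟨I, hI, fun i hi => hK _ (h (tmul_one_mem hi))⟩

theorem exists_right_smul_mem (x : SymQ Fl Fr M) :
    ∃ J ∈ Fr, ∀ j ∈ J, ∃ m, j • x = toSymQ Fl Fr M m := by
  obtain ⟨K, ⟨I, hI, J, hJ, h⟩, hK⟩ := GabrielFilter.exists_smul_mem x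
  exact ⟨J, hJ, fun j hj => hK _ (h (one_tmul_mem hj))⟩

theorem symQ_eq_zero {x : SymQ Fl Fr M} {I : Ideal R} {J : Ideal Rᵐᵒᵖ} (hI : I ∈ Fl) (hJ : J ∈ Fr)
    (h : ∀ i ∈ I, i • x = 0) (h' : ∀ j ∈ J, j • x = 0) : x = 0 := by
  have hle : symIdeal I J ≤ elemAnn (Env R) x :=
    symIdeal_le.2 ⟨fun i hi => mem_elemAnn.2 (h i hi), fun j hj => mem_elemAnn.2 (h' j hj)⟩
  exact GabrielFilter.modQ_eq_zero (F := symFilter Fl Fr) (M := EnvMod R M)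
    (K := symIdeal I J) ⟨I, hI, J, hJ, le_rfl⟩ (fun k hk => mem_elemAnn.1 (hle hk))

theorem symQ_ext {x y : SymQ Fl Fr M} {I : Ideal R} {J : Ideal Rᵐᵒᵖ} (hI : I ∈ Fl) (hJ : J ∈ Fr)
    (h : ∀ i ∈ I, i • x = i • y) (h' : ∀ j ∈ J, j • x = j • y) : x = y :=
  sub_eq_zero.1 (symQ_eq_zero hI hJ (fun i hi => by rw [smul_sub, h i hi, sub_self])
    (fun j hj => by rw [smul_sub, h' j hj, sub_self]))

/-- An auxiliary map on a tensor product, with values in germs along the filter of all ideals of a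
Gabriel filter: `r ⊗ s` is sent to the germ of `i ↦ f (i r) s`. -/
theorem exists_germ_map {A S : Type u} [Ring A] [AddCommGroup S] {N : Type w} [AddCommGroup N]
    (F : GabrielFilter A) {I : Ideal A} (hI : I ∈ F) (f : A → S →+ N)
    (hf : ∀ a ∈ I, ∀ b ∈ I, f (a + b) = f a + f b) :
    ∃ l : Filter A, (∀ K ∈ F, ∀ᶠ i in l, i ∈ K) ∧
      (∀ p : A → Prop, (∀ᶠ i in l, p i) → ∃ K ∈ F, ∀ i ∈ K, p i) ∧
      ∃ Ψ : A ⊗[ℤ] S →+ l.Germ N,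
        ∀ r s, Ψ (r ⊗ₜ s) = ((fun i => f (i * r) s : A → N) : l.Germ N) := by
  set l : Filter A := ⨅ K : F.Index, Filter.principal (K.ideal : Set A) with hl
  have hmem : ∀ K ∈ F, ∀ᶠ i in l, i ∈ K := fun K hK =>
    Filter.mem_iInf_of_mem (F.idx K hK) (Filter.mem_principal_self _)
  let B : A →+ S →+ l.Germ N :=
    AddMonoidHom.mk' (fun r => AddMonoidHom.mk'
      (fun s => ((fun i => f (i * r) s : A → N) : l.Germ N))
      (fun s t => by
        rw [← Filter.Germ.coe_add, Filter.Germ.coe_eq]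
        exact Filter.Eventually.of_forall (fun i => map_add _ _ _)))
      (fun r r' => by
        ext s
        change ((fun i => f (i * (r + r')) s : A → N) : l.Germ N) =
          ((fun i => f (i * r) s : A → N) : l.Germ N) + ((fun i => f (i * r') s : A → N) : l.Germ N)
        rw [← Filter.Germ.coe_add, Filter.Germ.coe_eq]
        filter_upwards [hmem _ (F.colon_mem hI r), hmem _ (F.colon_mem hI r')] with i h1 h2
        rw [mul_add, hf _ (mem_leftColon.1 h1) _ (mem_leftColon.1 h2)]
        rfl)
  refine ⟨l, hmem, fun p hp => ?_, TensorProduct.liftAddHom B (fun z a s => ?_), fun r s => rfl⟩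
  · have hdir : Directed (· ≥ ·) (fun K : F.Index => Filter.principal (K.ideal : Set A)) := by
      intro K L
      obtain ⟨P, h1, h2⟩ := exists_ge_ge K L
      exact ⟨P, Filter.principal_mono.2 h1, Filter.principal_mono.2 h2⟩
    obtain ⟨K, hK⟩ := (Filter.mem_iInf_of_directed hdir _).1 hp
    exact ⟨K.ideal, K.mem, fun i hi => hK hi⟩
  · rw [map_zsmul, map_zsmul]
    rfl

theorem symQ_exists_of_graph (Γ : Submodule (Env R) (Env R × SymQ Fl Fr M))
    (hΓ : ∀ n, (0, n) ∈ Γ → n = 0) (K : Ideal (Env R)) (hK : K ∈ symFilter Fl Fr)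
    (hKΓ : ∀ k ∈ K, ∃ n, (k, n) ∈ Γ) : ∃ x : SymQ Fl Fr M, ∀ a n, (a, n) ∈ Γ → a • x = n :=
  GabrielFilter.exists_of_graph (F := symFilter Fl Fr) (M := EnvMod R M) Γ hΓ K hK hKΓ

/-- An element of the symmetric module of quotients is given by a left and a right linear map that
are compatible. -/
theorem exists_of_pair {I : Ideal R} {J : Ideal Rᵐᵒᵖ} (hI : I ∈ Fl) (hJ : J ∈ Fr)
    (f : R → SymQ Fl Fr M) (g : Rᵐᵒᵖ → SymQ Fl Fr M)
    (hf : ∀ a ∈ I, ∀ b ∈ I, f (a + b) = f a + f b) (hf' : ∀ r, ∀ a ∈ I, f (r * a) = r • f a)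
    (hg : ∀ a ∈ J, ∀ b ∈ J, g (a + b) = g a + g b) (hg' : ∀ r, ∀ a ∈ J, g (r * a) = r • g a)
    (hfg : ∀ i ∈ I, ∀ j ∈ J, j • f i = i • g j) :
    ∃ x : SymQ Fl Fr M, (∀ i ∈ I, i • x = f i) ∧ ∀ j ∈ J, j • x = g j := by
  let T : Set (Env R × SymQ Fl Fr M) :=
    ((fun i : R => ((i ⊗ₜ[ℤ] 1 : Env R), f i)) '' I) ∪
      ((fun j : Rᵐᵒᵖ => ((1 ⊗ₜ[ℤ] j : Env R), g j)) '' J)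
  let Γ : Submodule (Env R) (Env R × SymQ Fl Fr M) := Submodule.span _ T
  have hΓ : ∀ n, ((0 : Env R), n) ∈ Γ → n = 0 := by
    obtain ⟨l, hl, hl', Ψ, hΨ⟩ := exists_germ_map (S := Rᵐᵒᵖ) (N := SymQ Fl Fr M) Fl hI
      (fun r => AddMonoidHom.mk' (fun s => s • f r) (fun s t => add_smul s t _))
      (fun a ha b hb => by ext s; simp [hf a ha b hb])
    obtain ⟨l₂, hl₂, hl₂', Ψ₂, hΨ₂⟩ := exists_germ_map (S := R) (N := SymQ Fl Fr M) Fr hJ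
      (fun s => AddMonoidHom.mk' (fun r => r • g s) (fun s t => add_smul s t _))
      (fun a ha b hb => by ext s; simp [hg a ha b hb])
    have h1 : ∀ x ∈ Γ, ((fun i => i • x.2 : R → SymQ Fl Fr M) : l.Germ _) = Ψ x.1 := by
      intro x hx
      induction hx using Submodule.closure_induction with
      | zero =>
        simp only [Prod.snd_zero, smul_zero]
        exact (map_zero _).symm
      | add x y _ _ h h' =>
        simp only [Prod.fst_add, Prod.snd_add, smul_add, map_add, ← h, ← h']; rfl
      | smul_mem e x hx =>
        induction e using TensorProduct.induction_on with
        | zero =>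
          have h0 : (0 : Env R) • x = 0 := zero_smul (Env R) x
          erw [h0]
          simp only [Prod.snd_zero, smul_zero]
          exact (map_zero Ψ).symm
        | add a b ha hb =>
          simp only [add_smul, Prod.fst_add, Prod.snd_add, smul_add, map_add, ← ha, ← hb]; rfl
        | tmul r s =>
          obtain ⟨i, hi, rfl⟩ | ⟨j, hj, rfl⟩ := hx
          · simp only [Prod.smul_mk, smul_eq_mul, Algebra.TensorProduct.tmul_mul_tmul, hΨ, mul_one]
            congr 1
            funext a
            rw [tmul_smul_symQ, ← mul_smul, smul_comm, ← hf' _ _ hi, ← mul_assoc]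
            rfl
          · simp only [Prod.smul_mk, smul_eq_mul, Algebra.TensorProduct.tmul_mul_tmul, hΨ, mul_one]
            rw [Filter.Germ.coe_eq]
            filter_upwards [hl _ (Fl.colon_mem hI r)] with a ha
            rw [tmul_smul_symQ, ← mul_smul, smul_comm, ← hfg _ (mem_leftColon.1 ha) _ hj,
              ← mul_smul]
            rfl
    have h2 : ∀ x ∈ Γ, ((fun i => i • x.2 : Rᵐᵒᵖ → SymQ Fl Fr M) : l₂.Germ _) =
        Ψ₂ (TensorProduct.comm ℤ R Rᵐᵒᵖ x.1) := by
      intro x hx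
      induction hx using Submodule.closure_induction with
      | zero =>
        simp only [Prod.snd_zero, smul_zero]
        exact ((congrArg Ψ₂ (map_zero _)).trans (map_zero _)).symm
      | add x y _ _ h h' =>
        simp only [Prod.fst_add, Prod.snd_add, smul_add, map_add, ← h, ← h']; rfl
      | smul_mem e x hx =>
        induction e using TensorProduct.induction_on with
        | zero =>
          have h0 : (0 : Env R) • x = 0 := zero_smul (Env R) x
          erw [h0]
          simp only [Prod.snd_zero, smul_zero]
          exact ((congrArg Ψ₂ (map_zero _)).trans (map_zero Ψ₂)).symm
        | add a b ha hb =>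
          simp only [add_smul, Prod.fst_add, Prod.snd_add, smul_add, map_add, ← ha, ← hb]; rfl
        | tmul r s =>
          obtain ⟨i, hi, rfl⟩ | ⟨j, hj, rfl⟩ := hx
          · simp only [Prod.smul_mk, smul_eq_mul, Algebra.TensorProduct.tmul_mul_tmul, mul_one,
              TensorProduct.comm_tmul, hΨ₂]
            rw [Filter.Germ.coe_eq]
            filter_upwards [hl₂ _ (Fr.colon_mem hJ s)] with a ha
            rw [tmul_smul_symQ, smul_comm r s, ← mul_smul, smul_comm, hfg _ hi _ (mem_leftColon.1 ha),
              ← mul_smul]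
            rfl
          · simp only [Prod.smul_mk, smul_eq_mul, Algebra.TensorProduct.tmul_mul_tmul, mul_one,
              TensorProduct.comm_tmul, hΨ₂]
            congr 1
            funext a
            rw [tmul_smul_symQ, smul_comm r s, ← mul_smul, smul_comm, ← hg' _ _ hj, ← mul_assoc]
            rfl
    intro n hn
    have e1 := h1 _ hn
    have e2 := h2 _ hn
    simp only [map_zero] at e1 e2
    obtain ⟨K, hK, hK'⟩ := hl' _ (Filter.Germ.coe_eq.1 e1)
    obtain ⟨L, hL, hL'⟩ := hl₂' _ (Filter.Germ.coe_eq.1 e2)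
    exact symQ_eq_zero hK hL hK' hL'
  have hdom : ∀ k ∈ symIdeal I J, ∃ n, (k, n) ∈ Γ := by
    intro k hk
    have hle : symIdeal I J ≤ Γ.map (LinearMap.fst (Env R) (Env R) (SymQ Fl Fr M)) := by
      refine symIdeal_le.2 ⟨fun i hi => ?_, fun j hj => ?_⟩
      · exact ⟨(i ⊗ₜ 1, f i), Submodule.subset_span (Or.inl ⟨i, hi, rfl⟩), rfl⟩
      · exact ⟨(1 ⊗ₜ j, g j), Submodule.subset_span (Or.inr ⟨j, hj, rfl⟩), rfl⟩
    obtain ⟨⟨a, n⟩, h, rfl⟩ := hle hk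
    exact ⟨n, h⟩
  obtain ⟨x, hx⟩ := symQ_exists_of_graph Γ hΓ
    (symIdeal I J) ⟨I, hI, J, hJ, le_rfl⟩ hdom
  exact ⟨x, fun i hi => hx _ _ (Submodule.subset_span (Or.inl ⟨i, hi, rfl⟩)),
    fun j hj => hx _ _ (Submodule.subset_span (Or.inr ⟨j, hj, rfl⟩))⟩

end

/-! ### The ring structure on the symmetric ring of quotients -/

section

variable {R : Type u} [Ring R] (Fl : GabrielFilter R) (Fr : GabrielFilter Rᵐᵒᵖ)

/-- The symmetric ring of quotients of `R`. -/
abbrev SymRing : Type u := SymQ Fl Fr R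

variable {Fl Fr}

/-- `z` is the product of `x` and `y`: if `i x = q(r)` then `i z = r y`, and if `y j = q(s)` then
`z j = x s`. -/
def IsSymProd (x y z : SymRing Fl Fr) : Prop :=
  (∀ i r : R, i • x = toSymQ Fl Fr R r → i • z = r • y) ∧
    ∀ (j : Rᵐᵒᵖ) (s : R), j • y = toSymQ Fl Fr R s → j • z = op s • x

theorem toSymQ_op (r s : R) : op s • toSymQ Fl Fr R r = r • toSymQ Fl Fr R s := by
  rw [← toSymQ_right_smul, ← toSymQ_left_smul]
  rfl

theorem ext_of_toSymQ {r r' : R} (h : toSymQ Fl Fr R r = toSymQ Fl Fr R r') :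
    (∃ K ∈ Fl, ∀ k ∈ K, k * r = k * r') ∧ ∃ K ∈ Fr, ∀ k ∈ K, r * unop k = r' * unop k := by
  have h0 : toSymQ Fl Fr R (r - r') = 0 := by rw [map_sub, h, sub_self]
  obtain ⟨I, hI, J, hJ, hle⟩ := (GabrielFilter.toModQ_eq_zero_iff _).1 h0
  rw [symIdeal_le] at hle
  refine ⟨⟨I, hI, fun k hk => ?_⟩, ⟨J, hJ, fun k hk => ?_⟩⟩
  · have := mem_elemAnn.1 (hle.1 k hk)
    rw [tmul_smul_toEnvMod, one_smul] at this
    have h2 : k * (r - r') = 0 := this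
    rwa [mul_sub, sub_eq_zero] at h2
  · have := mem_elemAnn.1 (hle.2 k hk)
    rw [tmul_smul_toEnvMod, one_smul] at this
    have h2 : (r - r') * unop k = 0 := this
    rwa [sub_mul, sub_eq_zero] at h2

theorem left_smul_congr {r r' : R} (h : toSymQ Fl Fr R r = toSymQ Fl Fr R r')
    (y : SymRing Fl Fr) : r • y = r' • y := by
  obtain ⟨⟨K, hK, hKr⟩, -⟩ := ext_of_toSymQ h
  obtain ⟨J, hJ, hy⟩ := exists_right_smul_mem y
  refine symQ_ext hK hJ (fun i hi => ?_) (fun j hj => ?_)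
  · rw [← mul_smul, ← mul_smul, hKr i hi]
  · obtain ⟨m, hm⟩ := hy j hj
    rw [smul_comm j, smul_comm j, hm, ← toSymQ_op, ← toSymQ_op, h]

theorem right_smul_congr {r r' : R} (h : toSymQ Fl Fr R r = toSymQ Fl Fr R r')
    (y : SymRing Fl Fr) : op r • y = op r' • y := by
  obtain ⟨-, ⟨K, hK, hKr⟩⟩ := ext_of_toSymQ h
  obtain ⟨J, hJ, hy⟩ := exists_left_smul_mem y
  refine symQ_ext hJ hK (fun i hi => ?_) (fun j hj => ?_)
  · obtain ⟨m, hm⟩ := hy i hi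
    rw [smul_comm, smul_comm i, hm, toSymQ_op, toSymQ_op, h]
  · rw [← mul_smul, ← mul_smul, ← op_unop j, ← op_mul, ← op_mul, hKr j hj]

theorem IsSymProd.unique {x y z z' : SymRing Fl Fr} (h : IsSymProd x y z) (h' : IsSymProd x y z') :
    z = z' := by
  obtain ⟨I, hI, hx⟩ := exists_left_smul_mem x
  obtain ⟨J, hJ, hy⟩ := exists_right_smul_mem y
  refine symQ_ext hI hJ (fun i hi => ?_) (fun j hj => ?_)
  · obtain ⟨m, hm⟩ := hx i hi
    rw [h.1 i m hm, h'.1 i m hm]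
  · obtain ⟨m, hm⟩ := hy j hj
    rw [h.2 j m hm, h'.2 j m hm]

theorem isSymProd_of_ideals {x y z : SymRing Fl Fr} {I : Ideal R} {J : Ideal Rᵐᵒᵖ}
    (hI : I ∈ Fl) (hJ : J ∈ Fr)
    (h : ∀ i ∈ I, ∃ r, i • x = toSymQ Fl Fr R r ∧ i • z = r • y)
    (h' : ∀ j ∈ J, ∃ s, j • y = toSymQ Fl Fr R s ∧ j • z = op s • x) : IsSymProd x y z := by
  refine ⟨fun i r hr => ?_, fun j s hs => ?_⟩
  · refine symQ_ext (Fl.colon_mem hI i) hJ (fun a ha => ?_) (fun j hj => ?_)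
    · obtain ⟨m, hm, hm'⟩ := h _ (mem_leftColon.1 ha)
      rw [← mul_smul, hm', ← mul_smul]
      refine left_smul_congr ?_ y
      rw [← hm, mul_smul, hr, ← toSymQ_left_smul]
      rfl
    · obtain ⟨s, hs, hs'⟩ := h' j hj
      rw [← smul_comm, hs', smul_comm, hr, ← smul_comm r, hs, toSymQ_op]
  · refine symQ_ext hI (Fr.colon_mem hJ j) (fun i hi => ?_) (fun a ha => ?_)
    · obtain ⟨r, hr, hr'⟩ := h i hi
      rw [smul_comm, hr', ← smul_comm r, hs, smul_comm i, hr, toSymQ_op]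
    · obtain ⟨m, hm, hm'⟩ := h' _ (mem_leftColon.1 ha)
      rw [← mul_smul, hm', ← mul_smul]
      have : a * op s = op (s * unop a) := by rw [op_mul, op_unop]
      rw [this]
      refine right_smul_congr ?_ x
      rw [← hm, mul_smul, hs, ← toSymQ_right_smul]
      rfl

theorem exists_isSymProd (x y : SymRing Fl Fr) : ∃ z, IsSymProd x y z := by
  classical
  obtain ⟨I, hI, hx⟩ := exists_left_smul_mem x
  obtain ⟨J, hJ, hy⟩ := exists_right_smul_mem y
  let f : R → SymRing Fl Fr := fun i =>
    if h : ∃ r, i • x = toSymQ Fl Fr R r then h.choose • y else 0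
  let g : Rᵐᵒᵖ → SymRing Fl Fr := fun j =>
    if h : ∃ s, j • y = toSymQ Fl Fr R s then op h.choose • x else 0
  have hf : ∀ i r, i • x = toSymQ Fl Fr R r → f i = r • y := by
    intro i r h
    have h' : ∃ r, i • x = toSymQ Fl Fr R r := ⟨r, h⟩
    simp only [f, dif_pos h']
    exact left_smul_congr (h'.choose_spec.symm.trans h) y
  have hg : ∀ j s, j • y = toSymQ Fl Fr R s → g j = op s • x := by
    intro j s h
    have h' : ∃ s, j • y = toSymQ Fl Fr R s := ⟨s, h⟩
    simp only [g, dif_pos h']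
    exact right_smul_congr (h'.choose_spec.symm.trans h) x
  obtain ⟨z, hz, hz'⟩ := exists_of_pair hI hJ f g
    (by
      intro a ha b hb
      obtain ⟨r, hr⟩ := hx a ha
      obtain ⟨s, hs⟩ := hx b hb
      rw [hf _ _ hr, hf _ _ hs, hf (a + b) (r + s) (by rw [add_smul, hr, hs, map_add]), add_smul])
    (by
      intro c a ha
      obtain ⟨r, hr⟩ := hx a ha
      rw [hf _ _ hr, hf (c * a) (c * r) (by rw [mul_smul, hr, ← toSymQ_left_smul]; rfl), mul_smul])
    (by
      intro a ha b hb
      obtain ⟨r, hr⟩ := hy a ha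
      obtain ⟨s, hs⟩ := hy b hb
      rw [hg _ _ hr, hg _ _ hs, hg (a + b) (r + s) (by rw [add_smul, hr, hs, map_add]), op_add,
        add_smul])
    (by
      intro c a ha
      obtain ⟨r, hr⟩ := hy a ha
      rw [hg _ _ hr, hg (c * a) (r * unop c) (by rw [mul_smul, hr, ← toSymQ_right_smul]; rfl),
        op_mul, op_unop, mul_smul])
    (by
      intro i hi j hj
      obtain ⟨r, hr⟩ := hx i hi
      obtain ⟨s, hs⟩ := hy j hj
      rw [hf _ _ hr, hg _ _ hs, ← smul_comm, hs, smul_comm, hr, toSymQ_op])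
  refine ⟨z, isSymProd_of_ideals hI hJ (fun i hi => ?_) (fun j hj => ?_)⟩
  · obtain ⟨r, hr⟩ := hx i hi
    exact ⟨r, hr, by rw [hz i hi, hf i r hr]⟩
  · obtain ⟨r, hr⟩ := hy j hj
    exact ⟨r, hr, by rw [hz' j hj, hg j r hr]⟩

instance : One (SymRing Fl Fr) := ⟨toSymQ Fl Fr R 1⟩

instance : Mul (SymRing Fl Fr) := ⟨fun x y => (exists_isSymProd x y).choose⟩

theorem isSymProd_mul (x y : SymRing Fl Fr) : IsSymProd x y (x * y) :=
  (exists_isSymProd x y).choose_spec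

theorem symOne_def : (1 : SymRing Fl Fr) = toSymQ Fl Fr R 1 := rfl

theorem left_smul_symOne (r : R) : r • (1 : SymRing Fl Fr) = toSymQ Fl Fr R r := by
  rw [symOne_def, ← toSymQ_left_smul, smul_eq_mul, mul_one]

theorem right_smul_symOne (r : R) : op r • (1 : SymRing Fl Fr) = toSymQ Fl Fr R r := by
  rw [symOne_def, ← toSymQ_right_smul, op_smul_eq_mul, one_mul]

theorem toSymQ_mul' (r : R) (y : SymRing Fl Fr) : toSymQ Fl Fr R r * y = r • y := by
  rw [← one_smul R (toSymQ Fl Fr R r * y)]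
  exact (isSymProd_mul _ y).1 1 r (one_smul _ _)

theorem mul_toSymQ' (x : SymRing Fl Fr) (s : R) : x * toSymQ Fl Fr R s = op s • x := by
  rw [← one_smul Rᵐᵒᵖ (x * toSymQ Fl Fr R s)]
  exact (isSymProd_mul x _).2 1 s (one_smul _ _)

theorem left_smul_mul' (r : R) (x y : SymRing Fl Fr) : (r • x) * y = r • (x * y) := by
  obtain ⟨I, hI, hx⟩ := exists_left_smul_mem x
  obtain ⟨J, hJ, hy⟩ := exists_right_smul_mem y
  refine IsSymProd.unique (isSymProd_mul _ _)
    (isSymProd_of_ideals (Fl.colon_mem hI r) hJ (fun i hi => ?_) (fun j hj => ?_))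
  · obtain ⟨m, hm⟩ := hx _ (mem_leftColon.1 hi)
    exact ⟨m, by rw [← mul_smul, hm], by rw [← mul_smul, (isSymProd_mul x y).1 _ m hm]⟩
  · obtain ⟨m, hm⟩ := hy j hj
    exact ⟨m, hm, by rw [← smul_comm, (isSymProd_mul x y).2 j m hm, smul_comm]⟩

theorem mul_right_smul' (s : Rᵐᵒᵖ) (x y : SymRing Fl Fr) : x * (s • y) = s • (x * y) := by
  obtain ⟨I, hI, hx⟩ := exists_left_smul_mem x
  obtain ⟨J, hJ, hy⟩ := exists_right_smul_mem y
  refine IsSymProd.unique (isSymProd_mul _ _)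
    (isSymProd_of_ideals hI (Fr.colon_mem hJ s) (fun i hi => ?_) (fun j hj => ?_))
  · obtain ⟨m, hm⟩ := hx i hi
    exact ⟨m, hm, by rw [smul_comm, (isSymProd_mul x y).1 i m hm, smul_comm]⟩
  · obtain ⟨m, hm⟩ := hy _ (mem_leftColon.1 hj)
    exact ⟨m, by rw [← mul_smul, hm],
      by rw [← mul_smul, ← (isSymProd_mul x y).2 (j * s) m hm]⟩

theorem add_symMul (x x' y : SymRing Fl Fr) : (x + x') * y = x * y + x' * y := by
  obtain ⟨I, hI, hx⟩ := exists_left_smul_mem x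
  obtain ⟨I', hI', hx'⟩ := exists_left_smul_mem x'
  obtain ⟨J, hJ, hy⟩ := exists_right_smul_mem y
  refine IsSymProd.unique (isSymProd_mul _ _)
    (isSymProd_of_ideals (Fl.inf_mem hI hI') hJ (fun i hi => ?_) (fun j hj => ?_))
  · obtain ⟨m, hm⟩ := hx i hi.1
    obtain ⟨m', hm'⟩ := hx' i hi.2
    exact ⟨m + m', by rw [smul_add, hm, hm', map_add], by
      rw [smul_add, (isSymProd_mul x y).1 i m hm, (isSymProd_mul x' y).1 i m' hm', add_smul]⟩
  · obtain ⟨m, hm⟩ := hy j hj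
    exact ⟨m, hm, by
      have h1 := (isSymProd_mul x y).2 j m hm
      have h2 := (isSymProd_mul x' y).2 j m hm
      rw [smul_add, h1, h2, smul_add]⟩

theorem symMul_add (x y y' : SymRing Fl Fr) : x * (y + y') = x * y + x * y' := by
  obtain ⟨I, hI, hx⟩ := exists_left_smul_mem x
  obtain ⟨J, hJ, hy⟩ := exists_right_smul_mem y
  obtain ⟨J', hJ', hy'⟩ := exists_right_smul_mem y'
  refine IsSymProd.unique (isSymProd_mul _ _)
    (isSymProd_of_ideals hI (Fr.inf_mem hJ hJ') (fun i hi => ?_) (fun j hj => ?_))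
  · obtain ⟨m, hm⟩ := hx i hi
    exact ⟨m, hm, by
      rw [smul_add, (isSymProd_mul x y).1 i m hm, (isSymProd_mul x y').1 i m hm, smul_add]⟩
  · obtain ⟨m, hm⟩ := hy j hj.1
    obtain ⟨m', hm'⟩ := hy' j hj.2
    exact ⟨m + m', by rw [smul_add, hm, hm', map_add], by
      have h1 := (isSymProd_mul x y).2 j m hm
      have h2 := (isSymProd_mul x y').2 j m' hm'
      rw [smul_add, h1, h2, op_add, add_smul]⟩

theorem symMul_assoc (x y z : SymRing Fl Fr) : x * y * z = x * (y * z) := by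
  obtain ⟨I, hI, hx⟩ := exists_left_smul_mem x
  obtain ⟨J, hJ, hz⟩ := exists_right_smul_mem z
  refine symQ_ext hI hJ (fun i hi => ?_) (fun j hj => ?_)
  · obtain ⟨r, hr⟩ := hx i hi
    rw [← left_smul_mul', ← left_smul_mul', ← left_smul_mul', hr, toSymQ_mul', toSymQ_mul',
      left_smul_mul']
  · obtain ⟨s, hs⟩ := hz j hj
    rw [← mul_right_smul', ← mul_right_smul', ← mul_right_smul', hs, mul_toSymQ', mul_toSymQ',
      mul_right_smul']

/-- The ring structure of the symmetric ring of quotients. -/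
instance : Ring (SymRing Fl Fr) :=
  { (inferInstance : AddCommGroup (SymRing Fl Fr)) with
    mul := (· * ·)
    one := 1
    left_distrib := symMul_add
    right_distrib := add_symMul
    mul_assoc := symMul_assoc
    one_mul := fun x => by rw [symOne_def, toSymQ_mul', one_smul]
    mul_one := fun x => by rw [symOne_def, mul_toSymQ', op_one, one_smul]
    zero_mul := fun x => by
      have h := toSymQ_mul' 0 x
      rwa [map_zero, zero_smul] at h
    mul_zero := fun x => by
      have h := mul_toSymQ' x 0
      rwa [map_zero, op_zero, zero_smul] at h }

variable (Fl Fr) in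
/-- The canonical ring homomorphism from `R` to the symmetric ring of quotients. -/
def toSymRing : R →+* SymRing Fl Fr where
  __ := toSymQ Fl Fr R
  map_one' := rfl
  map_mul' r s := by
    change toSymQ Fl Fr R (r * s) = toSymQ Fl Fr R r * toSymQ Fl Fr R s
    rw [toSymQ_mul', ← toSymQ_left_smul, smul_eq_mul]

end

/-! ### The Lambek, classical and Goldie filters -/

section

variable (A : Type u) [Ring A]

/-- The Gabriel filter of all dense left ideals: the filter of the Lambek torsion theory. -/
def lambekFilter : GabrielFilter A where
  ideals := {D | ∀ x y : A, y ≠ 0 → ∃ r : A, r * x ∈ D ∧ r * y ≠ 0}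
  top_mem := fun x y hy => ⟨1, trivial, by simpa using hy⟩
  mem_of_le := fun h hle x y hy => by
    obtain ⟨r, hr, hr'⟩ := h x y hy
    exact ⟨r, hle hr, hr'⟩
  inf_mem := fun {I J} hI hJ x y hy => by
    obtain ⟨r, hr, hr'⟩ := hI x y hy
    obtain ⟨s, hs, hs'⟩ := hJ (r * x) (r * y) hr'
    refine ⟨s * r, ⟨?_, ?_⟩, by rwa [mul_assoc]⟩
    · rw [mul_assoc]; exact I.mul_mem_left s hr
    · rw [mul_assoc]; exact hs
  colon_mem := fun {I} hI a x y hy => by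
    obtain ⟨r, hr, hr'⟩ := hI (x * a) y hy
    exact ⟨r, by rwa [mem_leftColon, mul_assoc], hr'⟩
  mem_of_colon := fun {I J} hJ h x y hy => by
    obtain ⟨r, hr, hr'⟩ := hJ x y hy
    obtain ⟨s, hs, hs'⟩ := h (r * x) hr 1 (r * y) hr'
    refine ⟨s * r, ?_, by rwa [mul_assoc]⟩
    rw [mul_one, mem_leftColon] at hs
    rwa [mul_assoc]

/-- The Gabriel filter of the classical torsion theory: `A / I` is torsion, i.e. every element of
`A / I` is annihilated by a regular element. -/
def classicalFilter : GabrielFilter A where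
  ideals := {I | ∀ a : A, ∃ t ∈ A⁰, t * a ∈ I}
  top_mem := fun _ => ⟨1, one_mem _, trivial⟩
  mem_of_le := fun h hle a => by
    obtain ⟨t, ht, h'⟩ := h a
    exact ⟨t, ht, hle h'⟩
  inf_mem := fun {I J} hI hJ a => by
    obtain ⟨t, ht, h⟩ := hI a
    obtain ⟨s, hs, h'⟩ := hJ (t * a)
    refine ⟨s * t, mul_mem hs ht, ⟨?_, ?_⟩⟩
    · rw [mul_assoc]; exact I.mul_mem_left s h
    · rw [mul_assoc]; exact h'
  colon_mem := fun {I} hI b a => by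
    obtain ⟨t, ht, h⟩ := hI (a * b)
    exact ⟨t, ht, by rwa [mem_leftColon, mul_assoc]⟩
  mem_of_colon := fun {I J} hJ h a => by
    obtain ⟨t, ht, h1⟩ := hJ a
    obtain ⟨s, hs, h2⟩ := h _ h1 1
    exact ⟨s * t, mul_mem hs ht, by
      rw [mul_one, mem_leftColon] at h2
      rwa [mul_assoc]⟩

variable {A}

/-- Essential left ideals: those that meet every nonzero left ideal. -/
def IsEssentialIdeal (I : Ideal A) : Prop := ∀ a : A, a ≠ 0 → ∃ r : A, r * a ∈ I ∧ r * a ≠ 0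

theorem IsEssentialIdeal.mono {I J : Ideal A} (h : IsEssentialIdeal I) (hle : I ≤ J) :
    IsEssentialIdeal J := fun a ha => by
  obtain ⟨r, hr, hr'⟩ := h a ha
  exact ⟨r, hle hr, hr'⟩

theorem IsEssentialIdeal.inf {I J : Ideal A} (h : IsEssentialIdeal I) (h' : IsEssentialIdeal J) :
    IsEssentialIdeal (I ⊓ J) := fun a ha => by
  obtain ⟨r, hr, hr'⟩ := h a ha
  obtain ⟨s, hs, hs'⟩ := h' _ hr'
  rw [← mul_assoc] at hs hs'
  exact ⟨s * r, ⟨by rw [mul_assoc]; exact I.mul_mem_left s hr, hs⟩, hs'⟩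

theorem IsEssentialIdeal.colon {I : Ideal A} (h : IsEssentialIdeal I) (b : A) :
    IsEssentialIdeal (leftColon I b) := fun a ha => by
  by_cases hab : a * b = 0
  · exact ⟨1, by simp [hab], by simpa using ha⟩
  · obtain ⟨r, hr, hr'⟩ := h _ hab
    refine ⟨r, by rwa [mem_leftColon, mul_assoc], fun h0 => hr' ?_⟩
    rw [← mul_assoc, h0, zero_mul]

variable (A) in
/-- The Gabriel filter of the Goldie torsion theory. -/
def goldieFilter : GabrielFilter A where
  ideals := {I | ∃ J : Ideal A, IsEssentialIdeal J ∧ ∀ j ∈ J, IsEssentialIdeal (leftColon I j)}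
  top_mem := ⟨⊤, fun a ha => ⟨1, trivial, by simpa using ha⟩,
    fun j _ a ha => ⟨1, by simp, by simpa using ha⟩⟩
  mem_of_le := by
    rintro I I' ⟨J, hJ, h⟩ hle
    exact ⟨J, hJ, fun j hj => (h j hj).mono (fun a ha => hle ha)⟩
  inf_mem := by
    rintro I I' ⟨J, hJ, h⟩ ⟨J', hJ', h'⟩
    exact ⟨J ⊓ J', hJ.inf hJ', fun j hj => ((h j hj.1).inf (h' j hj.2)).mono (fun a ha => ha)⟩
  colon_mem := by
    rintro I ⟨J, hJ, h⟩ a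
    refine ⟨leftColon J a, hJ.colon a, fun j hj => (h _ (mem_leftColon.1 hj)).mono (fun b hb => ?_)⟩
    simpa [mul_assoc] using hb
  mem_of_colon := by
    rintro I K ⟨J, hJ, h⟩ hK
    let E : Ideal A :=
      { carrier := {r | IsEssentialIdeal (leftColon I r)}
        zero_mem' := fun a ha => ⟨1, by simp, by simpa using ha⟩
        add_mem' := fun {a b} ha hb => (IsEssentialIdeal.inf ha hb).mono (fun c hc => by
          have h1 := mem_leftColon.1 hc.1
          have h2 := mem_leftColon.1 hc.2
          rw [mem_leftColon, mul_add]
          exact I.add_mem h1 h2)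
        smul_mem' := fun c a ha => (IsEssentialIdeal.colon ha c).mono (fun b hb => by
          simpa [mul_assoc] using hb) }
    refine ⟨E, fun a ha => ?_, fun j hj => hj⟩
    have hker : ∀ c : A, IsEssentialIdeal (elemAnn A c) → c ∈ E := fun c hc =>
      IsEssentialIdeal.mono hc (fun b hb => by
        have h0 : b * c = 0 := mem_elemAnn.1 hb
        simp [h0])
    obtain ⟨r, hr, hr'⟩ := hJ a ha
    by_cases h1 : ∀ s ∈ leftColon K (r * a), s * (r * a) = 0
    · exact ⟨r, hker _ ((h _ hr).mono (fun s hs => mem_elemAnn.2 (h1 s hs))), hr'⟩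
    · push Not at h1
      obtain ⟨s, hs, hs'⟩ := h1
      obtain ⟨L, hL, hL'⟩ := hK _ (mem_leftColon.1 hs)
      by_cases h2 : ∀ b ∈ L, b * (s * (r * a)) = 0
      · exact ⟨s * r, by
          rw [mul_assoc]
          exact hker _ (hL.mono (fun b hb => mem_elemAnn.2 (h2 b hb))), by rwa [mul_assoc]⟩
      · push Not at h2
        obtain ⟨b, hb, hb'⟩ := h2
        refine ⟨b * s * r, ?_, by rwa [mul_assoc, mul_assoc]⟩
        rw [mul_assoc, mul_assoc]
        refine (hL' b hb).mono (fun c hc => ?_)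
        simpa [mul_assoc] using hc

/-- A module is torsion-free for the Goldie torsion theory if and only if it is nonsingular, i.e.
`0` is its only element with essential annihilator. -/
theorem goldie_torsion_eq_bot_iff (M : Type v) [AddCommGroup M] [Module A M] :
    (goldieFilter A).torsion M = ⊥ ↔ ∀ x : M, IsEssentialIdeal (elemAnn A x) → x = 0 := by
  rw [Submodule.eq_bot_iff]
  constructor
  · intro h x hx
    exact h x ⟨elemAnn A x, hx, fun j _ => hx.colon j⟩
  · rintro h x ⟨J, hJ, hx⟩
    refine h x (hJ.mono (fun j hj => ?_))
    rw [mem_elemAnn]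
    refine h _ ((hx j hj).mono (fun b hb => ?_))
    simpa [mul_smul] using hb

end

/-! ### Perfect symmetric rings of quotients and the total one -/

section

variable {R : Type u} [Ring R]

/-- `f : R → S` makes `S` into a perfect symmetric ring of quotients, with corresponding filters
`{I | S f(I) = S}` and `{J | f(J) S = S}`. -/
structure IsPerfectSymRing {S : Type v} [Ring S] (f : R →+* S)
    (Fl : GabrielFilter R) (Fr : GabrielFilter Rᵐᵒᵖ) : Prop where
  left : ∀ I : Ideal R, I ∈ Fl ↔ Ideal.map f I = ⊤
  right : ∀ J : Ideal Rᵐᵒᵖ, J ∈ Fr ↔ Ideal.map (RingHom.op f) J = ⊤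
  iso : ∃ g : S ≃+* SymRing Fl Fr, ∀ r, g (f r) = toSymRing Fl Fr r

/-- The symmetric filter induced by `Fl` and `Fr` is perfect. -/
def IsPerfectPair (Fl : GabrielFilter R) (Fr : GabrielFilter Rᵐᵒᵖ) : Prop :=
  ∃ (S : Type u) (_ : Ring S) (f : R →+* S), IsPerfectSymRing f Fl Fr

/-- The pair of filters of the total symmetric ring of quotients, the largest perfect symmetric
ring of quotients that contains `R`. -/
structure IsTotalPair (Fl : GabrielFilter R) (Fr : GabrielFilter Rᵐᵒᵖ) : Prop where
  perfect : IsPerfectPair Fl Fr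
  left_faithful : Fl.IsFaithful
  right_faithful : Fr.IsFaithful
  largest : ∀ (Gl : GabrielFilter R) (Gr : GabrielFilter Rᵐᵒᵖ), IsPerfectPair Gl Gr →
    Gl.IsFaithful → Gr.IsFaithful → Gl ≤ Fl ∧ Gr ≤ Fr

end

/-! ### Derivations and the agreement of their extensions -/

section

variable {R : Type u} [Ring R]

/-- Derivations of a ring. -/
def IsRingDerivation (δ : R →+ R) : Prop := ∀ r s : R, δ (r * s) = δ r * s + r * δ s

/-- `δ`-derivations of a bimodule: `d(r x) = δ(r) x + r d(x)` and `d(x r) = d(x) r + x δ(r)`. -/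
structure IsBimoduleDerivation (δ : R →+ R) {M : Type v} [AddCommGroup M] [Module R M]
    [Module Rᵐᵒᵖ M] (d : M →+ M) : Prop where
  left : ∀ (r : R) (x : M), d (r • x) = δ r • x + r • d x
  right : ∀ (r : R) (x : M), d (op r • x) = op r • d x + op (δ r) • x

/-- The map `r ⊗ s ↦ δ(r) ⊗ s + r ⊗ δ(s)` on the enveloping ring. -/
def envDerivation (δ : R →+ R) : Env R →+ Env R :=
  (TensorProduct.map δ.toIntLinearMap LinearMap.id +
    TensorProduct.map LinearMap.id (AddMonoidHom.mulOp δ).toIntLinearMap :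
      R ⊗[ℤ] Rᵐᵒᵖ →ₗ[ℤ] R ⊗[ℤ] Rᵐᵒᵖ).toAddMonoidHom

/-- The symmetric filter is differential. -/
def IsDifferential (F : GabrielFilter (Env R)) : Prop :=
  ∀ δ : R →+ R, IsRingDerivation δ →
    ∀ I ∈ F, ∃ J ∈ F, ∀ a ∈ J, envDerivation δ a ∈ I

/-- `D` is an extension of the `δ`-derivation `d` to the symmetric module of quotients. -/
structure IsModuleExtension (Fl : GabrielFilter R) (Fr : GabrielFilter Rᵐᵒᵖ) (δ : R →+ R)
    {M : Type v} [AddCommGroup M] [Module R M] [Module Rᵐᵒᵖ M] [SMulCommClass R Rᵐᵒᵖ M]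
    (d : M →+ M) (D : SymQ Fl Fr M →+ SymQ Fl Fr M) : Prop where
  deriv : IsBimoduleDerivation δ D
  comm : ∀ x : M, D (toSymQ Fl Fr M x) = toSymQ Fl Fr M (d x)

/-- `D` is an extension of the derivation `δ` to a derivation of the symmetric ring of
quotients. -/
structure IsRingExtension (Fl : GabrielFilter R) (Fr : GabrielFilter Rᵐᵒᵖ) (δ : R →+ R)
    (D : SymRing Fl Fr →+ SymRing Fl Fr) : Prop where
  deriv : IsRingDerivation D
  comm : ∀ r : R, D (toSymRing Fl Fr r) = toSymRing Fl Fr (δ r)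

section

variable {Fl Gl : GabrielFilter R} {Fr Gr : GabrielFilter Rᵐᵒᵖ} (M : Type v) [AddCommGroup M]
  [Module R M] [Module Rᵐᵒᵖ M] [SMulCommClass R Rᵐᵒᵖ M]

/-- The canonical map between symmetric modules of quotients for an inclusion of symmetric
filters. -/
def symQMap (h : symFilter Fl Fr ≤ symFilter Gl Gr) : SymQ Fl Fr M →+ SymQ Gl Gr M :=
  GabrielFilter.modQMap (EnvMod R M) h

theorem symQMap_toSymQ (h : symFilter Fl Fr ≤ symFilter Gl Gr) (m : M) :
    symQMap M h (toSymQ Fl Fr M m) = toSymQ Gl Gr M m := by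
  classical
  refine (AddCommGroup.DirectLimit.lift_of _ _ _ _ _).trans ?_
  rfl

end

variable (Fl : GabrielFilter R) (Fr : GabrielFilter Rᵐᵒᵖ) (Gl : GabrielFilter R)
  (Gr : GabrielFilter Rᵐᵒᵖ) (δ : R →+ R)

/-- The first symmetric filter is contained in the second one, the derivation `d` extends uniquely
to both symmetric modules of quotients, and the two extensions agree. -/
def ModuleExtensionsAgree {M : Type v} [AddCommGroup M] [Module R M] [Module Rᵐᵒᵖ M]
    [SMulCommClass R Rᵐᵒᵖ M] (d : M →+ M) : Prop :=
  ∃ h : symFilter Fl Fr ≤ symFilter Gl Gr,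
    (∃! D₁, IsModuleExtension Fl Fr δ d D₁) ∧ (∃! D₂, IsModuleExtension Gl Gr δ d D₂) ∧
    ∀ D₁ D₂, IsModuleExtension Fl Fr δ d D₁ → IsModuleExtension Gl Gr δ d D₂ →
      ∀ x, symQMap M h (D₁ x) = D₂ (symQMap M h x)

/-- The first symmetric filter is contained in the second one, the derivation `δ` extends uniquely
to both symmetric rings of quotients, and the two extensions agree. -/
def RingExtensionsAgree : Prop :=
  ∃ h : symFilter Fl Fr ≤ symFilter Gl Gr,
    (∃! D₁, IsRingExtension Fl Fr δ D₁) ∧ (∃! D₂, IsRingExtension Gl Gr δ D₂) ∧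
    ∀ D₁ D₂, IsRingExtension Fl Fr δ D₁ → IsRingExtension Gl Gr δ D₂ →
      ∀ x, symQMap R h (D₁ x) = D₂ (symQMap R h x)

end

end

/-! Every Gabriel filter `F` is differential: for a derivation `Δ` and `I ∈ F`, the left ideal
`J = {a ∈ I | Δ a ∈ I}` is in `F`, because `(J : a)` contains `(I : Δ a)` for each `a ∈ I`. Hence
`Δ`-derivations `d` preserve torsion, and `D` extends `d` to the module of quotients if and only if
`a • D x = q (d m) - Δ a • x` whenever `a • x = q m`. This formula determines `D x`, since modules
of quotients are torsion-free; for the same reason the extensions commute with the canonical maps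
between modules of quotients. The extensions for two symmetric theories therefore agree as soon as
the one filter is contained in the other.

For the total ring of quotients, call a homomorphism `f : R →+* S` biperfect if every `s : S` has
enough left and right denominators: the ideals `{a | f a * s ∈ f R}` and `{b | s * f b ∈ f R}`
generate the unit ideal of `S`. Perfect symmetric rings of quotients with faithful filters are the
injective biperfect homomorphisms, and these embed into `Q_max`. The elements with enough
denominators form a subring, so the subring generated by all biperfect subrings of `Q_max` is
biperfect; it is the total ring of quotients. -/

/-! ### Derivations of modules of quotients -/

section

variable {A : Type u} [Ring A] {Δ : A →+ A} {M : Type v} [AddCommGroup M] [Module A M] {d : M →+ M}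

theorem IsRingDerivation.map_one (hΔ : IsRingDerivation Δ) : Δ 1 = 0 := by simpa using hΔ 1 1

/-- A `Δ`-derivation of a module over a ring `A` with a derivation `Δ`. -/
def IsModuleDerivation (Δ : A →+ A) (d : M →+ M) : Prop :=
  ∀ (a : A) (x : M), d (a • x) = Δ a • x + a • d x

/-- The left ideal `{a ∈ I | Δ a ∈ I}`, which witnesses that Gabriel filters are differential. -/
def derivationCore (hΔ : IsRingDerivation Δ) (I : Ideal A) : Ideal A where
  carrier := {a | a ∈ I ∧ Δ a ∈ I}
  zero_mem' := by simp
  add_mem' := fun ha hb => ⟨I.add_mem ha.1 hb.1, by rw [map_add]; exact I.add_mem ha.2 hb.2⟩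
  smul_mem' := fun c a ha => ⟨I.mul_mem_left c ha.1, by
    rw [smul_eq_mul, hΔ]
    exact I.add_mem (I.mul_mem_left _ ha.1) (I.mul_mem_left _ ha.2)⟩

namespace GabrielFilter

variable {F G : GabrielFilter A}

theorem derivationCore_mem (hΔ : IsRingDerivation Δ) {I : Ideal A} (hI : I ∈ F) :
    derivationCore hΔ I ∈ F := by
  refine F.mem_of_colon hI fun a ha => F.mem_of_le (F.colon_mem hI (Δ a)) fun b hb => ?_
  rw [mem_leftColon] at hb ⊢
  exact ⟨I.mul_mem_left b ha, by rw [hΔ]; exact I.add_mem (I.mul_mem_left _ ha) hb⟩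

theorem derivation_mem_torsion (hΔ : IsRingDerivation Δ) (hd : IsModuleDerivation Δ d) {x : M}
    (hx : x ∈ F.torsion M) : d x ∈ F.torsion M := by
  refine mem_torsion.2 (F.mem_of_le (derivationCore_mem hΔ (mem_torsion.1 hx)) fun a ha => ?_)
  have h := hd a x
  rwa [mem_elemAnn.1 ha.1, mem_elemAnn.1 ha.2, map_zero, zero_add, eq_comm] at h

theorem toModQ_derivation_eq_zero (hΔ : IsRingDerivation Δ) (hd : IsModuleDerivation Δ d) {m : M}
    (hm : F.toModQ M m = 0) : F.toModQ M (d m) = 0 :=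
  (toModQ_eq_zero_iff _).2 (derivation_mem_torsion hΔ hd ((toModQ_eq_zero_iff m).1 hm))

/-- The pairs `(a, q (d m) - Δ a • x)` with `a • x = q m`. They are the graph of the map
`a ↦ a • D x`, where `D` is the extension of `d` to the module of quotients. -/
def derivationGraph (hΔ : IsRingDerivation Δ) (hd : IsModuleDerivation Δ d) (x : F.ModQ M) :
    Submodule A (A × F.ModQ M) where
  carrier := {p | ∃ m, p.1 • x = F.toModQ M m ∧ p.2 = F.toModQ M (d m) - Δ p.1 • x}
  zero_mem' := ⟨0, by simp⟩
  add_mem' := by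
    rintro p p' ⟨m, h, h'⟩ ⟨n, k, k'⟩
    refine ⟨m + n, ?_, ?_⟩
    · rw [Prod.fst_add, add_smul, h, k, map_add]
    · rw [Prod.snd_add, h', k', Prod.fst_add, map_add, map_add, map_add, add_smul]
      abel
  smul_mem' := by
    rintro c p ⟨m, h, h'⟩
    refine ⟨c • m, ?_, ?_⟩
    · rw [Prod.smul_fst, smul_eq_mul, mul_smul, h, map_smul]
    · rw [Prod.smul_snd, h', Prod.smul_fst, smul_eq_mul, hΔ, hd, map_add, map_smul, map_smul,
        add_smul, mul_smul, mul_smul, h, smul_sub]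
      abel

theorem eq_zero_of_mem_derivationGraph (hΔ : IsRingDerivation Δ) (hd : IsModuleDerivation Δ d)
    {x y : F.ModQ M} (h : (0, y) ∈ derivationGraph hΔ hd x) : y = 0 := by
  obtain ⟨m, hm, rfl⟩ : ∃ m, (0 : A) • x = F.toModQ M m ∧ y = F.toModQ M (d m) - Δ 0 • x := h
  rw [zero_smul] at hm
  rw [toModQ_derivation_eq_zero hΔ hd hm.symm, map_zero, zero_smul, sub_zero]

theorem exists_derivation_value (hΔ : IsRingDerivation Δ) (hd : IsModuleDerivation Δ d)
    (x : F.ModQ M) :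
    ∃ y : F.ModQ M, ∀ a m, a • x = F.toModQ M m → a • y = F.toModQ M (d m) - Δ a • x := by
  obtain ⟨K, hK, hx⟩ := exists_smul_mem x
  have hdom : ∀ k ∈ K, ∃ n, (k, n) ∈ derivationGraph hΔ hd x := fun k hk => by
    obtain ⟨m, hm⟩ := hx k hk
    exact ⟨F.toModQ M (d m) - Δ k • x, m, hm, rfl⟩
  obtain ⟨y, hy⟩ := exists_of_graph _ (fun _ => eq_zero_of_mem_derivationGraph hΔ hd) K hK hdom
  exact ⟨y, fun a m h => hy _ _ ⟨m, h, rfl⟩⟩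

theorem exists_derivation_modQ (F : GabrielFilter A) (hΔ : IsRingDerivation Δ)
    (hd : IsModuleDerivation Δ d) :
    ∃ D : F.ModQ M →+ F.ModQ M, IsModuleDerivation Δ D ∧
      ∀ m, D (F.toModQ M m) = F.toModQ M (d m) := by
  choose D hD using exists_derivation_value (F := F) hΔ hd
  refine ⟨AddMonoidHom.mk' D fun x y => ?_, fun a x => ?_, fun m => ?_⟩
  · obtain ⟨K, hK, hx⟩ := exists_smul_mem x
    obtain ⟨L, hL, hy⟩ := exists_smul_mem y
    refine modQ_ext (F.inf_mem hK hL) fun k hk => ?_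
    obtain ⟨m, hm⟩ := hx k hk.1
    obtain ⟨n, hn⟩ := hy k hk.2
    have hmn : k • (x + y) = F.toModQ M (m + n) := by rw [smul_add, hm, hn, map_add]
    rw [smul_add, hD x k m hm, hD y k n hn, hD (x + y) k (m + n) hmn, map_add, map_add, smul_add]
    abel
  · obtain ⟨K, hK, hx⟩ := exists_smul_mem x
    refine modQ_ext (F.colon_mem hK a) fun k hk => ?_
    obtain ⟨m, hm⟩ := hx _ (mem_leftColon.1 hk)
    have hax := hD (a • x) k m (by rw [← mul_smul, hm])
    have hx := hD x (k * a) m hm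
    rw [hΔ, add_smul, mul_smul, mul_smul, mul_smul] at hx
    change k • D (a • x) = k • (Δ a • x + a • D x)
    rw [hax, smul_add, hx]
    abel
  · have h := hD (F.toModQ M m) 1 m (one_smul _ _)
    rwa [one_smul, hΔ.map_one, zero_smul, sub_zero] at h

variable {N : Type w} [AddCommGroup N] [Module A N]

/-- Applied with `E` and `E'` that measure the failure of linearity by the same term `c a x`. -/
theorem modQ_addMonoidHom_ext (h : F ≤ G) {E E' : F.ModQ M →+ G.ModQ N}
    {c : A → F.ModQ M → G.ModQ N} (hE : ∀ a x, E (a • x) = c a x + a • E x)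
    (hE' : ∀ a x, E' (a • x) = c a x + a • E' x)
    (hEE' : ∀ m, E (F.toModQ M m) = E' (F.toModQ M m)) : E = E' := by
  ext x
  obtain ⟨K, hK, hx⟩ := exists_smul_mem x
  refine modQ_ext (h _ hK) fun k hk => add_left_cancel (a := c k x) ?_
  obtain ⟨m, hm⟩ := hx k hk
  rw [← hE, ← hE', hm, hEE']

theorem existsUnique_derivation_modQ (F : GabrielFilter A) (hΔ : IsRingDerivation Δ)
    (hd : IsModuleDerivation Δ d) :
    ∃! D : F.ModQ M →+ F.ModQ M, IsModuleDerivation Δ D ∧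
      ∀ m, D (F.toModQ M m) = F.toModQ M (d m) := by
  obtain ⟨D, hD, hDd⟩ := F.exists_derivation_modQ hΔ hd
  refine ⟨D, ⟨hD, hDd⟩, fun D' ⟨hD', hDd'⟩ => ?_⟩
  exact modQ_addMonoidHom_ext (fun _ => id) hD' hD fun m => (hDd' m).trans (hDd m).symm

theorem modQMap_germ (h : F ≤ G) (K : F.Index) (φ : F.HomTF M K) :
    modQMap M h (F.germ M K φ) = G.germ M (G.idx K.ideal (h _ K.mem)) (tfQuotMap M h ∘ₗ φ) := by
  classical
  exact AddCommGroup.DirectLimit.lift_of _ _ _ K φ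

theorem modQMap_smul (h : F ≤ G) (a : A) (x : F.ModQ M) :
    modQMap M h (a • x) = a • modQMap M h x := by
  obtain ⟨K, φ, rfl⟩ := exists_germ x
  rw [smul_germ, modQMap_germ, modQMap_germ, smul_germ]
  exact germ_eq _ _ _ _ ⊤ G.top_mem fun _ _ _ _ => rfl

theorem modQMap_toModQ (h : F ≤ G) (m : M) : modQMap M h (F.toModQ M m) = G.toModQ M m :=
  (modQMap_germ h _ _).trans rfl

theorem modQMap_derivation (h : F ≤ G) {D₁ : F.ModQ M →+ F.ModQ M} {D₂ : G.ModQ M →+ G.ModQ M}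
    (hD₁ : IsModuleDerivation Δ D₁) (hDd₁ : ∀ m, D₁ (F.toModQ M m) = F.toModQ M (d m))
    (hD₂ : IsModuleDerivation Δ D₂) (hDd₂ : ∀ m, D₂ (G.toModQ M m) = G.toModQ M (d m))
    (x : F.ModQ M) : modQMap M h (D₁ x) = D₂ (modQMap M h x) := by
  suffices (modQMap M h).comp D₁ = D₂.comp (modQMap M h) from DFunLike.congr_fun this x
  refine modQ_addMonoidHom_ext h (c := fun a x => Δ a • modQMap M h x) (fun a x => ?_)
    (fun a x => ?_) fun m => ?_
  · simp only [AddMonoidHom.comp_apply, hD₁ a x, map_add, modQMap_smul]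
  · simp only [AddMonoidHom.comp_apply, modQMap_smul, hD₂ a]
  · simp only [AddMonoidHom.comp_apply, hDd₁, modQMap_toModQ, hDd₂]

end GabrielFilter

end

/-! ### Extensions to symmetric modules and rings of quotients -/

section

variable {R : Type u} [Ring R] {δ : R →+ R}

theorem envDerivation_tmul (δ : R →+ R) (r : R) (s : Rᵐᵒᵖ) :
    envDerivation δ (r ⊗ₜ[ℤ] s) = δ r ⊗ₜ[ℤ] s + r ⊗ₜ[ℤ] op (δ (unop s)) := rfl

theorem isRingDerivation_envDerivation (hδ : IsRingDerivation δ) :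
    IsRingDerivation (envDerivation δ) := by
  have h : ∀ r s, δ (r * s) = δ r * s + r * δ s := hδ
  intro a b
  induction a using TensorProduct.induction_on with
  | zero => simp
  | add x y hx hy => rw [add_mul, map_add, hx, hy, map_add, add_mul, add_mul]; abel
  | tmul r s =>
    induction b using TensorProduct.induction_on with
    | zero => simp
    | add x y hx hy => rw [mul_add, map_add, hx, hy, map_add, mul_add, mul_add]; abel
    | tmul r' s' =>
      simp only [envDerivation_tmul, Algebra.TensorProduct.tmul_mul_tmul, add_mul, mul_add, h,
        TensorProduct.add_tmul, TensorProduct.tmul_add, unop_mul, op_add, op_mul, op_unop]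
      abel

theorem isModuleDerivation_envDerivation_iff {N : Type v} [AddCommGroup N] [Module R N]
    [Module Rᵐᵒᵖ N] [Module (Env R) N] (hN : ∀ r s (x : N), (r ⊗ₜ[ℤ] s : Env R) • x = r • s • x)
    (hδ : IsRingDerivation δ) {d : N →+ N} :
    IsModuleDerivation (envDerivation δ) d ↔ IsBimoduleDerivation δ d := by
  refine ⟨fun hd => ⟨fun r x => ?_, fun r x => ?_⟩, fun hd a x => ?_⟩
  · simpa only [envDerivation_tmul, add_smul, hN, unop_one, hδ.map_one, op_zero, zero_smul,
      smul_zero, add_zero, one_smul] using hd (r ⊗ₜ[ℤ] 1) x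
  · simpa only [envDerivation_tmul, add_smul, hN, unop_op, hδ.map_one, zero_smul, zero_add,
      one_smul, add_comm] using hd (1 ⊗ₜ[ℤ] op r) x
  · induction a using TensorProduct.induction_on with
    | zero =>
      have h0 (y : N) : (0 : Env R) • y = 0 := zero_smul (Env R) y
      rw [map_zero, h0, h0, map_zero, add_zero]
    | add a b ha hb => rw [add_smul, map_add, ha, hb, map_add, add_smul, add_smul]; abel
    | tmul r s =>
      rw [envDerivation_tmul, add_smul, hN, hN, hN, hN, hd.left, ← op_unop s, hd.right, smul_add,
        op_unop]
      abel

variable {Fl Gl : GabrielFilter R} {Fr Gr : GabrielFilter Rᵐᵒᵖ}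
  {M : Type v} [AddCommGroup M] [Module R M] [Module Rᵐᵒᵖ M] [SMulCommClass R Rᵐᵒᵖ M]
  {d : M →+ M}

instance : Module R (EnvMod R M) := inferInstanceAs (Module R M)

instance : Module Rᵐᵒᵖ (EnvMod R M) := inferInstanceAs (Module Rᵐᵒᵖ M)

theorem IsBimoduleDerivation.isModuleDerivation (hδ : IsRingDerivation δ)
    (hd : IsBimoduleDerivation δ d) :
    IsModuleDerivation (A := Env R) (M := EnvMod R M) (envDerivation δ) d :=
  (isModuleDerivation_envDerivation_iff (N := EnvMod R M) (tmul_smul_toEnvMod R M) hδ).2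
    ⟨hd.left, hd.right⟩

theorem isModuleExtension_iff (hδ : IsRingDerivation δ) {D : SymQ Fl Fr M →+ SymQ Fl Fr M} :
    IsModuleExtension Fl Fr δ d D ↔ IsModuleDerivation (envDerivation δ) D ∧
      ∀ m, D (toSymQ Fl Fr M m) = toSymQ Fl Fr M (d m) := by
  rw [isModuleDerivation_envDerivation_iff tmul_smul_symQ hδ]
  exact ⟨fun h => ⟨h.deriv, h.comm⟩, fun h => ⟨h.1, h.2⟩⟩

variable (Fl Fr) in
theorem existsUnique_isModuleExtension (hδ : IsRingDerivation δ) (hd : IsBimoduleDerivation δ d) :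
    ∃! D, IsModuleExtension Fl Fr δ d D := by
  simp only [isModuleExtension_iff hδ]
  exact (symFilter Fl Fr).existsUnique_derivation_modQ (isRingDerivation_envDerivation hδ)
    (hd.isModuleDerivation hδ)

theorem moduleExtensionsAgree_of_le (h : symFilter Fl Fr ≤ symFilter Gl Gr)
    (hδ : IsRingDerivation δ) (hd : IsBimoduleDerivation δ d) :
    ModuleExtensionsAgree Fl Fr Gl Gr δ d := by
  refine ⟨h, existsUnique_isModuleExtension Fl Fr hδ hd, existsUnique_isModuleExtension Gl Gr hδ hd,
    fun D₁ D₂ h₁ h₂ => ?_⟩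
  obtain ⟨hD₁, hDd₁⟩ := (isModuleExtension_iff hδ).1 h₁
  obtain ⟨hD₂, hDd₂⟩ := (isModuleExtension_iff hδ).1 h₂
  exact GabrielFilter.modQMap_derivation h hD₁ hDd₁ hD₂ hDd₂

theorem toSymRing_mul (r : R) (x : SymRing Fl Fr) : toSymRing Fl Fr r * x = r • x := toSymQ_mul' r x

theorem mul_toSymRing (x : SymRing Fl Fr) (s : R) : x * toSymRing Fl Fr s = op s • x :=
  mul_toSymQ' x s

theorem symRing_ext {x y : SymRing Fl Fr} {I : Ideal R} {J : Ideal Rᵐᵒᵖ} (hI : I ∈ Fl) (hJ : J ∈ Fr)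
    (hl : ∀ i ∈ I, toSymRing Fl Fr i * x = toSymRing Fl Fr i * y)
    (hr : ∀ j ∈ J, x * toSymRing Fl Fr (unop j) = y * toSymRing Fl Fr (unop j)) : x = y :=
  symQ_ext hI hJ (fun i hi => by simpa only [toSymRing_mul] using hl i hi)
    fun j hj => by simpa only [mul_toSymRing, op_unop] using hr j hj

theorem exists_toSymRing_mul (x : SymRing Fl Fr) :
    ∃ I ∈ Fl, ∀ i ∈ I, ∃ r, toSymRing Fl Fr i * x = toSymRing Fl Fr r := by
  simp only [toSymRing_mul]
  exact exists_left_smul_mem x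

theorem exists_mul_toSymRing (x : SymRing Fl Fr) :
    ∃ J ∈ Fr, ∀ j ∈ J, ∃ s, x * toSymRing Fl Fr (unop j) = toSymRing Fl Fr s := by
  simp only [mul_toSymRing, op_unop]
  exact exists_right_smul_mem x

theorem IsRingDerivation.isBimoduleDerivation (hδ : IsRingDerivation δ) :
    IsBimoduleDerivation δ δ where
  left r x := hδ r x
  right r x := hδ x r

section

variable {D : SymRing Fl Fr →+ SymRing Fl Fr}

theorem IsModuleExtension.map_toSymRing_mul (h : IsModuleExtension Fl Fr δ δ D) (r : R)
    (x : SymRing Fl Fr) :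
    D (toSymRing Fl Fr r * x) = toSymRing Fl Fr (δ r) * x + toSymRing Fl Fr r * D x := by
  simpa only [toSymRing_mul] using h.deriv.left r x

theorem IsModuleExtension.map_mul_toSymRing (h : IsModuleExtension Fl Fr δ δ D)
    (x : SymRing Fl Fr) (s : R) :
    D (x * toSymRing Fl Fr s) = D x * toSymRing Fl Fr s + x * toSymRing Fl Fr (δ s) := by
  simpa only [mul_toSymRing] using h.deriv.right s x

theorem IsModuleExtension.isRingDerivation (h : IsModuleExtension Fl Fr δ δ D) :
    IsRingDerivation D := by
  intro x y
  obtain ⟨I, hI, hx⟩ := exists_toSymRing_mul x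
  obtain ⟨J, hJ, hy⟩ := exists_mul_toSymRing y
  have hq (r : R) : D (toSymRing Fl Fr r) = toSymRing Fl Fr (δ r) := h.comm r
  have hl := h.map_toSymRing_mul
  have hr := h.map_mul_toSymRing
  refine symRing_ext hI hJ ?_ ?_ <;> set q := toSymRing Fl Fr
  · intro i hi
    obtain ⟨r, hr⟩ := hx i hi
    have hDx : q i * D x = q (δ r) - q (δ i) * x := by rw [← hq r, ← hr, hl]; abel
    calc q i * D (x * y) = D (q r * y) - q (δ i) * (x * y) := by rw [← hr, mul_assoc, hl]; abel
      _ = q (δ r) * y + q i * x * D y - q (δ i) * x * y := by rw [hl, hr, mul_assoc]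
      _ = q i * (D x * y + x * D y) := by rw [mul_add, ← mul_assoc, hDx]; noncomm_ring
  · intro j hj
    obtain ⟨s, hs⟩ := hy j hj
    have hDy : D y * q (unop j) = q (δ s) - y * q (δ (unop j)) := by rw [← hq s, ← hs, hr]; abel
    calc D (x * y) * q (unop j) = D (x * q s) - x * y * q (δ (unop j)) := by
          rw [← hs, ← mul_assoc, hr]; abel
      _ = D x * (y * q (unop j)) + x * q (δ s) - x * (y * q (δ (unop j))) := by
          rw [hr, hs, mul_assoc]
      _ = (D x * y + x * D y) * q (unop j) := by
          rw [add_mul, mul_assoc x (D y), hDy]; noncomm_ring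

end

theorem isRingExtension_iff {D : SymRing Fl Fr →+ SymRing Fl Fr} :
    IsRingExtension Fl Fr δ D ↔ IsModuleExtension Fl Fr δ δ D := by
  refine ⟨fun h => ⟨⟨fun r x => ?_, fun s x => ?_⟩, h.comm⟩, fun h => ⟨h.isRingDerivation, h.comm⟩⟩
  · rw [← toSymRing_mul, h.deriv, h.comm, toSymRing_mul, toSymRing_mul]
  · rw [← mul_toSymRing, h.deriv, h.comm, mul_toSymRing, mul_toSymRing]

theorem ringExtensionsAgree_of_le (h : symFilter Fl Fr ≤ symFilter Gl Gr)
    (hδ : IsRingDerivation δ) : RingExtensionsAgree Fl Fr Gl Gr δ := by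
  obtain ⟨h', h₁, h₂, h₁₂⟩ := moduleExtensionsAgree_of_le h hδ hδ.isBimoduleDerivation
  simp only [← isRingExtension_iff] at h₁ h₂ h₁₂
  exact ⟨h', h₁, h₂, h₁₂⟩

theorem symFilter_mono (hl : Fl ≤ Gl) (hr : Fr ≤ Gr) : symFilter Fl Fr ≤ symFilter Gl Gr := by
  rintro K ⟨I, hI, J, hJ, h⟩
  exact ⟨I, hl I hI, J, hr J hJ, h⟩

end

/-! ### Faithful filters -/

section

variable {A : Type u} [Ring A] {F : GabrielFilter A}

theorem GabrielFilter.IsFaithful.eq_zero (hF : F.IsFaithful) {I : Ideal A} (hI : I ∈ F) {x : A}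
    (h : ∀ i ∈ I, i * x = 0) : x = 0 :=
  (Submodule.eq_bot_iff _).1 hF x (F.mem_of_le hI fun i hi => mem_elemAnn.2 (h i hi))

theorem GabrielFilter.isFaithful_of_eq_zero
    (h : ∀ I ∈ F, ∀ x : A, (∀ i ∈ I, i * x = 0) → x = 0) : F.IsFaithful :=
  (Submodule.eq_bot_iff _).2 fun x hx => h _ hx x fun _ hi => mem_elemAnn.1 hi

theorem GabrielFilter.IsFaithful.le_lambekFilter (hF : F.IsFaithful) : F ≤ lambekFilter A := by
  intro I hI x y hy
  by_contra! h
  exact hy (hF.eq_zero (F.colon_mem hI x) fun i hi => h i (mem_leftColon.1 hi))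

variable (A) in
theorem lambekFilter_isFaithful : (lambekFilter A).IsFaithful := by
  refine GabrielFilter.isFaithful_of_eq_zero fun I hI x hx => ?_
  by_contra h
  obtain ⟨r, hr, hr'⟩ := hI 1 x h
  exact hr' (hx r (by simpa using hr))

variable (A) in
theorem lambekFilter_le_goldieFilter : lambekFilter A ≤ goldieFilter A := by
  have hess : ∀ I ∈ lambekFilter A, IsEssentialIdeal I := fun I hI a ha => hI a a ha
  exact fun I hI => ⟨I, hess I hI, fun j _ => hess _ ((lambekFilter A).colon_mem hI j)⟩

theorem GabrielFilter.IsFaithful.le_goldieFilter (hF : F.IsFaithful) : F ≤ goldieFilter A :=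
  fun I hI => lambekFilter_le_goldieFilter A I (hF.le_lambekFilter I hI)

variable (A) in
theorem classicalFilter_isFaithful : (classicalFilter A).IsFaithful := by
  refine GabrielFilter.isFaithful_of_eq_zero fun I hI x hx => ?_
  obtain ⟨t, ht, h⟩ := hI 1
  rw [mul_one] at h
  exact (mem_nonZeroDivisors_iff.1 ht).1 x (hx t h)

theorem toSymRing_injective {Fl : GabrielFilter A} {Fr : GabrielFilter Aᵐᵒᵖ} (h : Fl.IsFaithful) :
    Function.Injective (toSymRing Fl Fr) := by
  refine (injective_iff_map_eq_zero _).2 fun r hr => ?_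
  obtain ⟨⟨K, hK, hKr⟩, -⟩ := ext_of_toSymQ (hr.trans (map_zero (toSymRing Fl Fr)).symm)
  exact h.eq_zero hK fun k hk => (hKr k hk).trans (mul_zero k)

end

/-! ### Perfect homomorphisms -/

section

variable {A : Type u} [Ring A] {S : Type v} [Ring S] {T : Type w} [Ring T] {f : A →+* S}
  {I J : Ideal A} {s t : S}

/-- The left ideal of the denominators `a` of `s`, i.e. those with `f a * s ∈ f I`. -/
def denominators (f : A →+* S) (I : Ideal A) (s : S) : Ideal A where
  carrier := {a | ∃ b ∈ I, f a * s = f b}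
  zero_mem' := ⟨0, I.zero_mem, by simp⟩
  add_mem' := by
    rintro a a' ⟨b, hb, h⟩ ⟨b', hb', h'⟩
    exact ⟨b + b', I.add_mem hb hb', by rw [map_add, add_mul, h, h', map_add]⟩
  smul_mem' := by
    rintro c a ⟨b, hb, h⟩
    exact ⟨c * b, I.mul_mem_left c hb, by rw [smul_eq_mul, map_mul, mul_assoc, h, map_mul]⟩

theorem mem_denominators {a : A} : a ∈ denominators f I s ↔ ∃ b ∈ I, f a * s = f b := Iff.rfl

theorem mem_denominators_top {a : A} : a ∈ denominators f ⊤ s ↔ ∃ b, f a * s = f b := by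
  simp only [mem_denominators, Submodule.mem_top, true_and]

theorem mem_denominators_op_top {a : Aᵐᵒᵖ} :
    a ∈ denominators (RingHom.op f) ⊤ (op s) ↔ ∃ b, s * f (unop a) = f b := by
  simp only [mem_denominators_top, op_surjective.exists]
  exact exists_congr fun _ => op_injective.eq_iff

theorem map_eq_top_of_le (hJ : J.map f = ⊤) (h : J ≤ I) : I.map f = ⊤ :=
  top_unique (hJ ▸ Ideal.map_mono h)

theorem map_comp_eq_top (φ : S →+* T) (hI : I.map f = ⊤) : I.map (φ.comp f) = ⊤ := by
  rw [← Ideal.map_map, hI, Ideal.map_top]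

theorem map_op_comp_eq_top (φ : S →+* T) {J : Ideal Aᵐᵒᵖ} (hJ : J.map (RingHom.op f) = ⊤) :
    J.map (RingHom.op (φ.comp f)) = ⊤ := by
  have h : RingHom.op (φ.comp f) = (RingHom.op φ).comp (RingHom.op f) := RingHom.ext fun _ => rfl
  rw [h, map_comp_eq_top (RingHom.op φ) hJ]

theorem map_eq_top_of_leftColon (hJ : J.map f = ⊤) (h : ∀ a ∈ J, (leftColon I a).map f = ⊤) :
    I.map f = ⊤ := by
  rw [eq_top_iff, ← hJ, Ideal.map_le_iff_le_comap]
  intro a ha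
  have hle : (leftColon I a).map f ≤ leftColon (I.map f) (f a) := by
    refine Ideal.map_le_iff_le_comap.2 fun b hb => ?_
    rw [Ideal.mem_comap, mem_leftColon, ← map_mul]
    exact Ideal.mem_map_of_mem f (mem_leftColon.1 hb)
  rw [h a ha] at hle
  have h1 : (1 : S) ∈ leftColon (I.map f) (f a) := hle Submodule.mem_top
  rwa [mem_leftColon, one_mul] at h1

theorem eq_zero_of_map_eq_top (hI : I.map f = ⊤) (hs : ∀ i ∈ I, f i * s = 0) : s = 0 := by
  have hle : I.map f ≤ elemAnn S s :=
    Ideal.map_le_iff_le_comap.2 fun i hi => mem_elemAnn.2 (hs i hi)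
  rw [hI] at hle
  simpa only [mem_elemAnn, one_smul] using hle (Submodule.mem_top (x := 1))

/-- The condition that, for every `a`, the elements multiplying `f a * s` into `f I` generate `S`
as a left ideal. Quantifying over `a` makes it stable under products. -/
def HasDenominators (f : A →+* S) (I : Ideal A) (s : S) : Prop :=
  ∀ a : A, (denominators f I (f a * s)).map f = ⊤

theorem hasDenominators_of_mem {b : A} (hb : b ∈ I) : HasDenominators f I (f b) := fun a => by
  refine map_eq_top_of_le (Ideal.map_top f) fun c _ => ⟨c * (a * b), ?_, by simp only [map_mul]⟩
  exact I.mul_mem_left _ (I.mul_mem_left _ hb)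

theorem HasDenominators.add (hs : HasDenominators f I s) (ht : HasDenominators f I t) :
    HasDenominators f I (s + t) := fun a => by
  refine map_eq_top_of_leftColon (hs a) fun r hr => map_eq_top_of_le (ht (r * a)) ?_
  rintro c ⟨b, hb, h⟩
  obtain ⟨b', hb', h'⟩ := hr
  refine mem_leftColon.2 ⟨c * b' + b, I.add_mem (I.mul_mem_left c hb') hb, ?_⟩
  rw [RingHom.map_add f, ← h, RingHom.map_mul f c b', ← h']
  simp only [map_mul, mul_add, mul_assoc]

theorem HasDenominators.mul (hs : HasDenominators f ⊤ s) (ht : HasDenominators f I t) :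
    HasDenominators f I (s * t) := fun a => by
  refine map_eq_top_of_leftColon (hs a) fun r hr => ?_
  obtain ⟨b', -, h'⟩ := hr
  refine map_eq_top_of_le (ht b') ?_
  rintro c ⟨b, hb, h⟩
  refine mem_leftColon.2 ⟨b, hb, ?_⟩
  rw [← h, ← h']
  simp only [map_mul, mul_assoc]

theorem HasDenominators.comp (hs : HasDenominators f I s) (φ : S →+* T) :
    HasDenominators (φ.comp f) I (φ s) := fun a => by
  refine map_eq_top_of_le (map_comp_eq_top φ (hs a)) ?_
  rintro c ⟨b, hb, h⟩
  exact ⟨b, hb, by simp only [RingHom.comp_apply, ← h, map_mul]⟩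

/-- The subring of the elements of `S` with enough denominators in `A`. -/
def denominatorSubring (f : A →+* S) : Subring S where
  carrier := {s | HasDenominators f ⊤ s}
  zero_mem' := by simpa using hasDenominators_of_mem (f := f) (Submodule.zero_mem ⊤)
  one_mem' := by simpa using hasDenominators_of_mem (f := f) (I := ⊤) (b := 1) trivial
  add_mem' := HasDenominators.add
  mul_mem' := HasDenominators.mul
  neg_mem' := fun {s} hs => by
    have h := (hasDenominators_of_mem (f := f) (I := ⊤) (b := -1) trivial).mul hs
    rwa [map_neg, map_one, neg_one_mul] at h

/-- A homomorphism `f : A →+* S` is (left) perfect if every element of `S` has enough denominators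
in `A`. For injective `f` this is the criterion of Popescu and Spircu for `f` to be
an epimorphism of rings with `S` flat as a right `A`-module. -/
def IsPerfectHom (f : A →+* S) : Prop := ∀ s : S, (denominators f ⊤ s).map f = ⊤

theorem isPerfectHom_iff_forall_mem_denominatorSubring :
    IsPerfectHom f ↔ ∀ s, s ∈ denominatorSubring f :=
  ⟨fun hf s a => hf (f a * s), fun h s => by simpa only [map_one, one_mul] using h s 1⟩

theorem IsPerfectHom.map_leftColon (hf : IsPerfectHom f) (hinj : Function.Injective f)
    (hI : I.map f = ⊤) (a : A) : (leftColon I a).map f = ⊤ := by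
  have hden : ∀ y ∈ I.map f, HasDenominators f I y := by
    intro y hy
    induction hy using Submodule.span_induction with
    | mem y hy =>
      obtain ⟨i, hi, rfl⟩ := hy
      exact hasDenominators_of_mem hi
    | zero => simpa using hasDenominators_of_mem (f := f) I.zero_mem
    | add y z _ _ hy hz => exact hy.add hz
    | smul s y _ hy => exact (isPerfectHom_iff_forall_mem_denominatorSubring.1 hf s).mul hy
  refine map_eq_top_of_le (hden 1 (hI ▸ Submodule.mem_top) a) ?_
  rintro c ⟨b, hb, h⟩
  rw [mul_one, ← map_mul] at h
  rwa [mem_leftColon, hinj h]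

/-- The Gabriel filter `{I | S f(I) = S}` of an injective perfect homomorphism. -/
def perfectFilter (f : A →+* S) (hinj : Function.Injective f) (hf : IsPerfectHom f) :
    GabrielFilter A where
  ideals := {I | I.map f = ⊤}
  top_mem := Ideal.map_top f
  mem_of_le := map_eq_top_of_le
  inf_mem := fun hI hJ => map_eq_top_of_leftColon hI fun a ha =>
    map_eq_top_of_le (hf.map_leftColon hinj hJ a) fun b hb =>
      mem_leftColon.2 ⟨Ideal.mul_mem_left _ b ha, mem_leftColon.1 hb⟩
  colon_mem := fun hI a => hf.map_leftColon hinj hI a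
  mem_of_colon := map_eq_top_of_leftColon

theorem GabrielFilter.isFaithful_of_map_eq_top {F : GabrielFilter A} (hinj : Function.Injective f)
    (hF : ∀ I ∈ F, I.map f = ⊤) : F.IsFaithful := by
  refine isFaithful_of_eq_zero fun I hI x hx => hinj ?_
  rw [map_zero]
  exact eq_zero_of_map_eq_top (hF I hI) fun i hi => by rw [← map_mul, hx i hi, map_zero]

theorem GabrielFilter.mem_of_map_eq_top {F : GabrielFilter A} (hinj : Function.Injective f)
    (hF : ∀ s, denominators f ⊤ s ∈ F) (hI : I.map f = ⊤) : I ∈ F := by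
  have hden : ∀ y ∈ I.map f, denominators f I y ∈ F := by
    intro y hy
    induction hy using Submodule.span_induction with
    | mem y hy =>
      obtain ⟨i, hi, rfl⟩ := hy
      exact F.mem_of_le F.top_mem fun c _ => ⟨c * i, I.mul_mem_left c hi, (map_mul f c i).symm⟩
    | zero => exact F.mem_of_le F.top_mem fun c _ => ⟨0, I.zero_mem, by rw [mul_zero, map_zero]⟩
    | add y z _ _ hy hz =>
      refine F.mem_of_le (F.inf_mem hy hz) ?_
      rintro c ⟨⟨b, hb, h⟩, b', hb', h'⟩
      exact ⟨b + b', I.add_mem hb hb', by rw [mul_add, h, h', map_add]⟩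
    | smul s y _ hy =>
      refine F.mem_of_colon (hF s) fun r hr => ?_
      obtain ⟨b, h⟩ := mem_denominators_top.1 hr
      refine F.mem_of_le (F.colon_mem hy b) fun c hc => ?_
      obtain ⟨b', hb', h'⟩ := mem_leftColon.1 hc
      refine mem_leftColon.2 ⟨b', hb', ?_⟩
      rw [← h', map_mul, map_mul, ← h, smul_eq_mul, mul_assoc, mul_assoc, mul_assoc]
  refine F.mem_of_le (hden 1 (hI ▸ Submodule.mem_top)) ?_
  rintro c ⟨b, hb, h⟩
  rw [mul_one] at h
  rwa [hinj h]

end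

/-! ### Lifting to the symmetric ring of quotients -/

section

variable {R : Type u} [Ring R] {S : Type v} [Ring S] {f : R →+* S} {Fl : GabrielFilter R}
  {Fr : GabrielFilter Rᵐᵒᵖ} {s : S} {x : SymRing Fl Fr}

/-- The ring `S` is an overring of `R` whose elements have denominators, on both sides, that
belong to the filters. Such an overring lifts to the symmetric ring of quotients. -/
structure HasSymDenominators (Fl : GabrielFilter R) (Fr : GabrielFilter Rᵐᵒᵖ) (f : R →+* S) :
    Prop where
  injective : Function.Injective f
  left_mem : ∀ s, denominators f ⊤ s ∈ Fl
  right_mem : ∀ s, denominators (RingHom.op f) ⊤ (op s) ∈ Fr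

/-- The element `x` of the symmetric ring of quotients satisfies the equations with coefficients in
`R` that hold for the element `s` of the overring `S`. -/
structure Represents (f : R →+* S) (s : S) (x : SymRing Fl Fr) : Prop where
  left : ∀ {i m}, f i * s = f m → toSymRing Fl Fr i * x = toSymRing Fl Fr m
  right : ∀ {j m}, s * f j = f m → x * toSymRing Fl Fr j = toSymRing Fl Fr m

theorem HasSymDenominators.exists_represents (hf : HasSymDenominators Fl Fr f) (s : S) :
    ∃ x : SymRing Fl Fr, Represents f s x := by
  choose! m hm using fun i (hi : i ∈ denominators f ⊤ s) => mem_denominators_top.1 hi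
  choose! n hn using fun j (hj : j ∈ denominators (RingHom.op f) ⊤ (op s)) =>
    mem_denominators_op_top.1 hj
  obtain ⟨x, hl, hr⟩ := exists_of_pair (hf.left_mem s) (hf.right_mem s)
    (fun i => toSymRing Fl Fr (m i)) (fun j => toSymRing Fl Fr (n j))
    (fun a ha b hb => by
      rw [← map_add]
      refine congrArg _ (hf.injective ?_)
      rw [← hm _ (Ideal.add_mem _ ha hb), map_add, map_add, add_mul, hm a ha, hm b hb])
    (fun r a ha => by
      rw [← toSymRing_mul, ← map_mul]
      refine congrArg _ (hf.injective ?_)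
      rw [← hm _ (Ideal.mul_mem_left _ r ha), map_mul, map_mul, mul_assoc, hm a ha])
    (fun a ha b hb => by
      rw [← map_add]
      refine congrArg _ (hf.injective ?_)
      rw [← hn _ (Ideal.add_mem _ ha hb), unop_add, map_add, map_add, mul_add, hn a ha, hn b hb])
    (fun r a ha => by
      rw [← op_unop r, ← mul_toSymRing, ← map_mul]
      refine congrArg _ (hf.injective ?_)
      rw [← hn _ (Ideal.mul_mem_left _ _ ha), unop_mul, map_mul, map_mul, ← mul_assoc, hn a ha,
        unop_op])
    (fun i hi j hj => by
      rw [← toSymRing_mul, ← op_unop j, ← mul_toSymRing, ← map_mul, ← map_mul]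
      refine congrArg _ (hf.injective ?_)
      rw [map_mul, map_mul, op_unop, ← hn j hj, ← hm i hi, mul_assoc])
  refine ⟨x, fun {i k} h => ?_, fun {j k} h => ?_⟩
  · have hi : i ∈ denominators f ⊤ s := mem_denominators_top.2 ⟨k, h⟩
    rw [toSymRing_mul, hl i hi]
    exact congrArg _ (hf.injective ((hm i hi).symm.trans h))
  · have hj : op j ∈ denominators (RingHom.op f) ⊤ (op s) := mem_denominators_op_top.2 ⟨k, h⟩
    rw [mul_toSymRing, hr (op j) hj]
    exact congrArg _ (hf.injective ((hn (op j) hj).symm.trans h))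

theorem HasSymDenominators.eq_of_represents (hf : HasSymDenominators Fl Fr f)
    {y : SymRing Fl Fr} (hx : Represents f s x) (hy : Represents f s y) : x = y := by
  refine symRing_ext (hf.left_mem s) (hf.right_mem s) (fun i hi => ?_) fun j hj => ?_
  · obtain ⟨m, hm⟩ := mem_denominators_top.1 hi
    rw [hx.left hm, hy.left hm]
  · obtain ⟨m, hm⟩ := mem_denominators_op_top.1 hj
    rw [hx.right hm, hy.right hm]

theorem represents_toSymRing (hinj : Function.Injective f) (r : R) :
    Represents f (f r) (toSymRing Fl Fr r) where
  left h := by rw [← map_mul] at h ⊢; rw [hinj h]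
  right h := by rw [← map_mul] at h ⊢; rw [hinj h]

/-- The homomorphism under `R` from an overring with denominators in the filters to the symmetric
ring of quotients. -/
noncomputable def symRingLift (hf : HasSymDenominators Fl Fr f) : S →+* SymRing Fl Fr where
  toFun s := (hf.exists_represents s).choose
  map_one' := hf.eq_of_represents (hf.exists_represents 1).choose_spec <| by
    simpa only [map_one] using represents_toSymRing hf.injective (1 : R)
  map_zero' := hf.eq_of_represents (hf.exists_represents 0).choose_spec <| by
    simpa only [map_zero] using represents_toSymRing hf.injective (0 : R)
  map_mul' s t := by
    have hs := (hf.exists_represents s).choose_spec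
    have ht := (hf.exists_represents t).choose_spec
    have hst := (hf.exists_represents (s * t)).choose_spec
    refine symRing_ext (Fl.inf_mem (hf.left_mem s) (hf.left_mem (s * t)))
      (Fr.inf_mem (hf.right_mem t) (hf.right_mem (s * t))) ?_ ?_
    · rintro i ⟨hi, hi'⟩
      obtain ⟨m, hm⟩ := mem_denominators_top.1 hi
      obtain ⟨n, hn⟩ := mem_denominators_top.1 hi'
      rw [hst.left hn, ← mul_assoc, hs.left hm, ht.left]
      rw [← hn, ← hm, mul_assoc]
    · rintro j ⟨hj, hj'⟩
      obtain ⟨m, hm⟩ := mem_denominators_op_top.1 hj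
      obtain ⟨n, hn⟩ := mem_denominators_op_top.1 hj'
      rw [hst.right hn, mul_assoc, ht.right hm, hs.right]
      rw [← hn, ← hm, mul_assoc]
  map_add' s t := by
    have hs := (hf.exists_represents s).choose_spec
    have ht := (hf.exists_represents t).choose_spec
    have hst := (hf.exists_represents (s + t)).choose_spec
    refine symRing_ext (Fl.inf_mem (hf.left_mem s) (hf.left_mem t))
      (Fr.inf_mem (hf.right_mem s) (hf.right_mem t)) ?_ ?_
    · rintro i ⟨hi, hi'⟩
      obtain ⟨m, hm⟩ := mem_denominators_top.1 hi
      obtain ⟨n, hn⟩ := mem_denominators_top.1 hi'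
      rw [mul_add, hs.left hm, ht.left hn, ← map_add, hst.left]
      rw [mul_add, hm, hn, map_add]
    · rintro j ⟨hj, hj'⟩
      obtain ⟨m, hm⟩ := mem_denominators_op_top.1 hj
      obtain ⟨n, hn⟩ := mem_denominators_op_top.1 hj'
      rw [add_mul, hs.right hm, ht.right hn, ← map_add, hst.right]
      rw [add_mul, hm, hn, map_add]

theorem represents_symRingLift (hf : HasSymDenominators Fl Fr f) (s : S) :
    Represents f s (symRingLift hf s) :=
  (hf.exists_represents s).choose_spec

theorem symRingLift_comp (hf : HasSymDenominators Fl Fr f) :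
    (symRingLift hf).comp f = toSymRing Fl Fr :=
  RingHom.ext fun r => hf.eq_of_represents (represents_symRingLift hf (f r))
    (represents_toSymRing hf.injective r)

end

/-! ### Perfect symmetric rings of quotients -/

section

variable {R : Type u} [Ring R] {S : Type v} [Ring S] {T : Type w} [Ring T] {f : R →+* S}
  {Fl : GabrielFilter R} {Fr : GabrielFilter Rᵐᵒᵖ}

theorem exists_mul_map_eq {I : Ideal R} {x : SymRing Fl Fr}
    (hinj : Function.Injective (toSymRing Fl Fr)) (hI : I.map f = ⊤)
    (hx : ∀ i ∈ I, ∃ m, toSymRing Fl Fr i * x = toSymRing Fl Fr m) :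
    ∃ s, ∀ {j n}, x * toSymRing Fl Fr j = toSymRing Fl Fr n → s * f j = f n := by
  suffices h : ∀ y ∈ I.map f, ∃ s, ∀ {j n}, x * toSymRing Fl Fr j = toSymRing Fl Fr n →
      s * f j = y * f n by
    simpa only [one_mul] using h 1 (hI ▸ Submodule.mem_top)
  intro y hy
  induction hy using Submodule.span_induction with
  | mem y hy =>
    obtain ⟨i, hi, rfl⟩ := hy
    obtain ⟨m, hm⟩ := hx i hi
    refine ⟨f m, fun {j n} h => ?_⟩
    rw [← map_mul, ← map_mul]
    refine congrArg f (hinj ?_)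
    rw [map_mul, map_mul, ← hm, ← h, mul_assoc]
  | zero => exact ⟨0, fun _ => by rw [zero_mul, zero_mul]⟩
  | add y z _ _ hy hz =>
    obtain ⟨s, hs⟩ := hy
    obtain ⟨t, ht⟩ := hz
    exact ⟨s + t, fun h => by rw [add_mul, add_mul, hs h, ht h]⟩
  | smul r y _ hy =>
    obtain ⟨s, hs⟩ := hy
    exact ⟨r * s, fun h => by rw [smul_eq_mul, mul_assoc, mul_assoc, hs h]⟩

theorem symRingLift_bijective (hf : HasSymDenominators Fl Fr f) (hl : ∀ I ∈ Fl, I.map f = ⊤)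
    (hr : ∀ J ∈ Fr, J.map (RingHom.op f) = ⊤) : Function.Bijective (symRingLift hf) := by
  have hinj : Function.Injective (toSymRing Fl Fr) :=
    toSymRing_injective (GabrielFilter.isFaithful_of_map_eq_top hf.injective hl)
  refine ⟨(injective_iff_map_eq_zero _).2 fun s hs => ?_, fun x => ?_⟩
  · refine eq_zero_of_map_eq_top (hl _ (hf.left_mem s)) fun i hi => ?_
    obtain ⟨m, hm⟩ := mem_denominators_top.1 hi
    have hm0 : toSymRing Fl Fr m = 0 := by
      rw [← (represents_symRingLift hf s).left hm, hs, mul_zero]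
    rw [hm, (map_eq_zero_iff _ hinj).1 hm0, map_zero]
  · obtain ⟨I, hI, hxI⟩ := exists_toSymRing_mul x
    obtain ⟨J, hJ, hxJ⟩ := exists_mul_toSymRing x
    obtain ⟨s, hs⟩ := exists_mul_map_eq hinj (hl I hI) hxI
    have hs' {i m} (h : toSymRing Fl Fr i * x = toSymRing Fl Fr m) : f i * s = f m := by
      refine sub_eq_zero.1 (op_injective (eq_zero_of_map_eq_top (hr J hJ) fun j hj => ?_))
      obtain ⟨n, hn⟩ := hxJ j hj
      have hmn : m * unop j = i * n := hinj <| by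
        rw [map_mul, map_mul, ← h, ← hn, mul_assoc]
      refine unop_injective ?_
      change (f i * s - f m) * f (unop j) = 0
      rw [sub_mul, mul_assoc, hs hn, ← map_mul, ← map_mul, hmn, sub_self]
    refine ⟨s, symRing_ext hI hJ (fun i hi => ?_) fun j hj => ?_⟩
    · obtain ⟨m, hm⟩ := hxI i hi
      rw [hm, (represents_symRingLift hf s).left (hs' hm)]
    · obtain ⟨n, hn⟩ := hxJ j hj
      rw [hn, (represents_symRingLift hf s).right (hs hn)]

theorem HasSymDenominators.isPerfectSymRing (hf : HasSymDenominators Fl Fr f)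
    (hl : ∀ I ∈ Fl, I.map f = ⊤) (hr : ∀ J ∈ Fr, J.map (RingHom.op f) = ⊤) :
    IsPerfectSymRing f Fl Fr where
  left I := ⟨hl I, GabrielFilter.mem_of_map_eq_top hf.injective hf.left_mem⟩
  right J := ⟨hr J, GabrielFilter.mem_of_map_eq_top (op_injective.comp
    (hf.injective.comp unop_injective)) fun s => hf.right_mem (unop s)⟩
  iso := ⟨RingEquiv.ofBijective _ (symRingLift_bijective hf hl hr),
    DFunLike.congr_fun (symRingLift_comp hf)⟩

/-- A homomorphism that is perfect on both sides. -/
structure IsBiperfectHom (f : R →+* S) : Prop where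
  left : IsPerfectHom f
  right : IsPerfectHom (RingHom.op f)

theorem IsBiperfectHom.isPerfectSymRing (hf : IsBiperfectHom f) (hinj : Function.Injective f) :
    IsPerfectSymRing f (perfectFilter f hinj hf.left) (perfectFilter (RingHom.op f)
      (op_injective.comp (hinj.comp unop_injective)) hf.right) :=
  HasSymDenominators.isPerfectSymRing ⟨hinj, hf.left, fun s => hf.right (op s)⟩ (fun _ => id)
    fun _ => id

theorem IsPerfectSymRing.injective (hf : IsPerfectSymRing f Fl Fr) (hFl : Fl.IsFaithful) :
    Function.Injective f := by
  obtain ⟨g, hg⟩ := hf.iso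
  exact Function.Injective.of_comp (f := g) (by
    simpa only [Function.comp_def, hg] using toSymRing_injective hFl)

theorem IsPerfectSymRing.isBiperfectHom (hf : IsPerfectSymRing f Fl Fr) : IsBiperfectHom f := by
  obtain ⟨g, hg⟩ := hf.iso
  refine ⟨fun s => ?_, op_surjective.forall.2 fun s => ?_⟩
  · obtain ⟨I, hI, h⟩ := exists_toSymRing_mul (g s)
    refine map_eq_top_of_le ((hf.left I).1 hI) fun i hi => mem_denominators_top.2 ?_
    obtain ⟨m, hm⟩ := h i hi
    exact ⟨m, g.injective (by rw [map_mul, hg, hg, hm])⟩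
  · obtain ⟨J, hJ, h⟩ := exists_mul_toSymRing (g s)
    refine map_eq_top_of_le ((hf.right J).1 hJ) fun j hj => mem_denominators_op_top.2 ?_
    obtain ⟨n, hn⟩ := h j hj
    exact ⟨n, g.injective (by rw [map_mul, hg, hg, hn])⟩

theorem IsPerfectHom.comp_of_surjective (hf : IsPerfectHom f) {φ : S →+* T}
    (hφ : Function.Surjective φ) : IsPerfectHom (φ.comp f) := by
  simp only [isPerfectHom_iff_forall_mem_denominatorSubring, hφ.forall] at hf ⊢
  exact fun s => HasDenominators.comp (hf s) φ

theorem IsBiperfectHom.comp_of_surjective (hf : IsBiperfectHom f) {φ : S →+* T}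
    (hφ : Function.Surjective φ) : IsBiperfectHom (φ.comp f) where
  left := hf.left.comp_of_surjective hφ
  right := hf.right.comp_of_surjective (φ := RingHom.op φ)
    (op_surjective.comp (hφ.comp unop_surjective))

end

/-! ### The total symmetric ring of quotients -/

section

variable {R : Type u} [Ring R] {Q : Type v} [Ring Q] {q : R →+* Q}

/-- The subring `T` of the overring `Q` of `R` contains `R` and is biperfect over it. -/
def IsBiperfectSubring (q : R →+* Q) (T : Subring Q) : Prop :=
  ∃ f : R →+* T, T.subtype.comp f = q ∧ IsBiperfectHom f

/-- The supremum of the biperfect subrings of an overring `Q` of `R`. It is the largest one. -/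
def biperfectClosure (q : R →+* Q) : Subring Q := sSup {T | IsBiperfectSubring q T}

theorem isPerfectHom_of_surjective (hq : Function.Surjective q) : IsPerfectHom q := fun s => by
  obtain ⟨r, rfl⟩ := hq s
  exact map_eq_top_of_le (Ideal.map_top q) fun i _ =>
    mem_denominators_top.2 ⟨i * r, (map_mul q i r).symm⟩

theorem isBiperfectSubring_range (q : R →+* Q) : IsBiperfectSubring q q.range :=
  ⟨q.rangeRestrict, rfl, isPerfectHom_of_surjective q.rangeRestrict_surjective,
    isPerfectHom_of_surjective
      (op_surjective.comp (q.rangeRestrict_surjective.comp unop_surjective))⟩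

theorem le_biperfectClosure {T : Subring Q} (hT : IsBiperfectSubring q T) :
    T ≤ biperfectClosure q := le_sSup hT

theorem mem_biperfectClosure (q : R →+* Q) (r : R) : q r ∈ biperfectClosure q :=
  le_biperfectClosure (isBiperfectSubring_range q) ⟨r, rfl⟩

/-- The inclusion of `R` into the largest biperfect subring of `Q`. -/
def toBiperfectClosure (q : R →+* Q) : R →+* biperfectClosure q :=
  q.codRestrict _ (mem_biperfectClosure q)

theorem biperfectClosure_induction {U : Subring (biperfectClosure q)}
    (hU : ∀ {T : Subring Q} (φ : T →+* biperfectClosure q) (f : R →+* T),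
      IsBiperfectHom f → φ.comp f = toBiperfectClosure q → ∀ t, φ t ∈ U)
    (s : biperfectClosure q) : s ∈ U := by
  suffices h : biperfectClosure q ≤ U.map (biperfectClosure q).subtype by
    obtain ⟨u, hu, hus⟩ := h s.2
    rwa [← Subtype.ext hus]
  refine sSup_le fun T hT t ht => ?_
  have ⟨f, hf, hf'⟩ := hT
  refine ⟨_, hU (Subring.inclusion (le_biperfectClosure hT)) f hf' ?_ ⟨t, ht⟩, rfl⟩
  exact RingHom.ext fun r => Subtype.ext (DFunLike.congr_fun hf r)

theorem isBiperfectHom_toBiperfectClosure (q : R →+* Q) :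
    IsBiperfectHom (toBiperfectClosure q) where
  left := by
    refine isPerfectHom_iff_forall_mem_denominatorSubring.2 (biperfectClosure_induction ?_)
    intro T φ f hf hφ t
    rw [← hφ]
    exact (isPerfectHom_iff_forall_mem_denominatorSubring.1 hf.left t).comp φ
  right := by
    refine isPerfectHom_iff_forall_mem_denominatorSubring.2 (op_surjective.forall.2 fun s => ?_)
    refine Subring.mem_unop.1 (biperfectClosure_induction ?_ s)
    intro T φ f hf hφ t
    rw [← hφ]
    exact (isPerfectHom_iff_forall_mem_denominatorSubring.1 hf.right (op t)).comp (RingHom.op φ)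

theorem exists_comp_eq_toBiperfectClosure {S : Type w} [Ring S] {f : R →+* S}
    (hf : IsBiperfectHom f) {φ : S →+* Q} (h : φ.comp f = q) :
    ∃ ψ : S →+* biperfectClosure q, ψ.comp f = toBiperfectClosure q := by
  have hφ : IsBiperfectSubring q φ.range :=
    ⟨φ.rangeRestrict.comp f, h, hf.comp_of_surjective φ.rangeRestrict_surjective⟩
  exact ⟨(Subring.inclusion (le_biperfectClosure hφ)).comp φ.rangeRestrict,
    RingHom.ext fun r => Subtype.ext (DFunLike.congr_fun h r)⟩

end

section

variable {R : Type u} [Ring R] {S : Type v} [Ring S] {f : R →+* S} {Fl : GabrielFilter R}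
  {Fr : GabrielFilter Rᵐᵒᵖ}

theorem IsPerfectSymRing.hasSymDenominators_lambekFilter (hf : IsPerfectSymRing f Fl Fr)
    (hl : Fl.IsFaithful) (hr : Fr.IsFaithful) :
    HasSymDenominators (lambekFilter R) (lambekFilter Rᵐᵒᵖ) f where
  injective := hf.injective hl
  left_mem s := hl.le_lambekFilter _ ((hf.left _).2 (hf.isBiperfectHom.left s))
  right_mem s := hr.le_lambekFilter _ ((hf.right _).2 (hf.isBiperfectHom.right (op s)))

variable (R) in
theorem exists_isTotalPair : ∃ (Tl : GabrielFilter R) (Tr : GabrielFilter Rᵐᵒᵖ),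
    IsTotalPair Tl Tr := by
  let q := toSymRing (lambekFilter R) (lambekFilter Rᵐᵒᵖ)
  have hinj : Function.Injective (toBiperfectClosure q) :=
    (toSymRing_injective (lambekFilter_isFaithful R)).codRestrict (mem_biperfectClosure q)
  have hop : Function.Injective (RingHom.op (toBiperfectClosure q)) :=
    op_injective.comp (hinj.comp unop_injective)
  have hbi := isBiperfectHom_toBiperfectClosure q
  refine ⟨perfectFilter _ hinj hbi.left, perfectFilter _ hop hbi.right,
    ⟨_, _, _, hbi.isPerfectSymRing hinj⟩,
    GabrielFilter.isFaithful_of_map_eq_top hinj fun _ => id,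
    GabrielFilter.isFaithful_of_map_eq_top hop fun _ => id, ?_⟩
  rintro Gl Gr ⟨S, _, f, hf⟩ hGl hGr
  obtain ⟨ψ, hψ⟩ := exists_comp_eq_toBiperfectClosure hf.isBiperfectHom
    (symRingLift_comp (hf.hasSymDenominators_lambekFilter hGl hGr))
  refine ⟨fun I hI => ?_, fun J hJ => ?_⟩
  · have h := map_comp_eq_top ψ ((hf.left I).1 hI)
    rwa [hψ] at h
  · have h := map_op_comp_eq_top ψ ((hf.right J).1 hJ)
    rwa [hψ] at h

end

/-! ### The classical ring of quotients -/

section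

variable {A : Type u} [Ring A] {S : Type v} [Ring S] {f : A →+* S}

/-- The ring `S` is a left ring of fractions of `A` at the regular elements, i.e. its elements are
the fractions `t⁻¹ a`. -/
structure IsLeftFractionRing (f : A →+* S) : Prop where
  injective : Function.Injective f
  isUnit {t : A} (ht : t ∈ A⁰) : IsUnit (f t)
  exists_mul_eq (s : S) : ∃ t ∈ A⁰, ∃ a, f t * s = f a

theorem IsLeftFractionRing.map_eq_top (hf : IsLeftFractionRing f) {I : Ideal A}
    (hI : I ∈ classicalFilter A) : I.map f = ⊤ := by
  obtain ⟨t, ht, h⟩ := hI 1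
  rw [mul_one] at h
  exact Ideal.eq_top_of_isUnit_mem _ (Ideal.mem_map_of_mem f h) (hf.isUnit ht)

theorem IsLeftFractionRing.denominators_mem (hf : IsLeftFractionRing f) (s : S) :
    denominators f ⊤ s ∈ classicalFilter A := by
  intro a
  obtain ⟨t, ht, b, h⟩ := hf.exists_mul_eq (f a * s)
  exact ⟨t, ht, mem_denominators_top.2 ⟨b, by rw [map_mul, mul_assoc, h]⟩⟩

theorem IsLeftFractionRing.isPerfectSymRing (hl : IsLeftFractionRing f)
    (hr : IsLeftFractionRing (RingHom.op f)) :
    IsPerfectSymRing f (classicalFilter A) (classicalFilter Aᵐᵒᵖ) :=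
  HasSymDenominators.isPerfectSymRing
    ⟨hl.injective, hl.denominators_mem, fun s => hr.denominators_mem (op s)⟩
    (fun _ => hl.map_eq_top) fun _ => hr.map_eq_top

theorem op_mem_nonZeroDivisors {t : A} (ht : t ∈ A⁰) : op t ∈ Aᵐᵒᵖ⁰ :=
  ⟨fun x hx => unop_injective (ht.2 (unop x) (congrArg unop hx)),
    fun x hx => unop_injective (ht.1 (unop x) (congrArg unop hx))⟩

theorem unop_mem_nonZeroDivisors {t : Aᵐᵒᵖ} (ht : t ∈ Aᵐᵒᵖ⁰) : unop t ∈ A⁰ :=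
  ⟨fun x hx => op_injective (ht.2 (op x) (congrArg op hx)),
    fun x hx => op_injective (ht.1 (op x) (congrArg op hx))⟩

theorem isLeftFractionRing_numeratorRingHom [OreLocalization.OreSet A⁰] :
    IsLeftFractionRing (OreLocalization.numeratorRingHom : A →+* OreLocalization A⁰ A) where
  injective := OreLocalization.numeratorHom_inj inf_le_left
  isUnit ht := OreLocalization.numerator_isUnit ⟨_, ht⟩
  exists_mul_eq s := by
    induction s with
    | _ a t => exact ⟨t, t.2, a, OreLocalization.mul_cancel⟩

theorem IsLeftFractionRing.ringHom_op [OreLocalization.OreSet (Aᵐᵒᵖ)⁰] (hf : IsLeftFractionRing f) :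
    IsLeftFractionRing (RingHom.op f) where
  injective := op_injective.comp (hf.injective.comp unop_injective)
  isUnit ht := (hf.isUnit (unop_mem_nonZeroDivisors ht)).op
  exists_mul_eq := op_surjective.forall.2 fun s => by
    obtain ⟨t, ht, a, h⟩ := hf.exists_mul_eq s
    let t' : Aᵐᵒᵖ⁰ := ⟨op t, op_mem_nonZeroDivisors ht⟩
    let u := OreLocalization.oreDenom (op a) t'
    let b := OreLocalization.oreNum (op a) t'
    have hub : a * unop (u : Aᵐᵒᵖ) = t * unop b :=
      congrArg unop (OreLocalization.ore_eq (op a) t')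
    refine ⟨u, u.2, b, unop_injective ((hf.isUnit ht).mul_left_cancel ?_)⟩
    change f t * (s * f (unop (u : Aᵐᵒᵖ))) = f t * f (unop b)
    rw [← mul_assoc, h, ← map_mul, ← map_mul, hub]

end

theorem mainTheorem9 {R : Type u} [Ring R] (δ : R →+ R) (hδ : IsRingDerivation δ)
    {M : Type v} [AddCommGroup M] [Module R M] [Module Rᵐᵒᵖ M] [SMulCommClass R Rᵐᵒᵖ M]
    (d : M →+ M) (hd : IsBimoduleDerivation δ d) :
    ∃ (Tl : GabrielFilter R) (Tr : GabrielFilter Rᵐᵒᵖ), IsTotalPair Tl Tr ∧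
      -- (1) rings of quotients for faithful symmetric theories, and the total one
      ((∀ (Fl : GabrielFilter R) (Fr : GabrielFilter Rᵐᵒᵖ), Fl.IsFaithful → Fr.IsFaithful →
          RingExtensionsAgree Fl Fr (lambekFilter R) (lambekFilter Rᵐᵒᵖ) δ) ∧
        RingExtensionsAgree Tl Tr (lambekFilter R) (lambekFilter Rᵐᵒᵖ) δ) ∧
      -- (2) modules of quotients for differential faithful symmetric theories
      ((∀ (Fl : GabrielFilter R) (Fr : GabrielFilter Rᵐᵒᵖ), Fl.IsFaithful → Fr.IsFaithful →
          IsDifferential (symFilter Fl Fr) →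
          ModuleExtensionsAgree Fl Fr (lambekFilter R) (lambekFilter Rᵐᵒᵖ) δ d) ∧
        ModuleExtensionsAgree Tl Tr (lambekFilter R) (lambekFilter Rᵐᵒᵖ) δ d) ∧
      -- (3) the classical ring of quotients of a left and right Ore ring
      (∀ (_ : OreLocalization.OreSet R⁰) (_ : OreLocalization.OreSet (Rᵐᵒᵖ)⁰),
        (∃ e : OreLocalization R⁰ R ≃+* SymRing (classicalFilter R) (classicalFilter Rᵐᵒᵖ),
          ∀ r : R, e (OreLocalization.numeratorRingHom r) =
            toSymRing (classicalFilter R) (classicalFilter Rᵐᵒᵖ) r) ∧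
        RingExtensionsAgree (classicalFilter R) (classicalFilter Rᵐᵒᵖ)
          (lambekFilter R) (lambekFilter Rᵐᵒᵖ) δ ∧
        RingExtensionsAgree (classicalFilter R) (classicalFilter Rᵐᵒᵖ) Tl Tr δ) ∧
      -- (4) the symmetric Goldie ring of quotients
      (RingExtensionsAgree (lambekFilter R) (lambekFilter Rᵐᵒᵖ)
          (goldieFilter R) (goldieFilter Rᵐᵒᵖ) δ ∧
        ∀ (Fl : GabrielFilter R) (Fr : GabrielFilter Rᵐᵒᵖ), Fl.IsFaithful → Fr.IsFaithful →
          RingExtensionsAgree Fl Fr (goldieFilter R) (goldieFilter Rᵐᵒᵖ) δ) := by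
  obtain ⟨Tl, Tr, hT⟩ := exists_isTotalPair R
  have agree {Fl Gl : GabrielFilter R} {Fr Gr : GabrielFilter Rᵐᵒᵖ} (hl : Fl ≤ Gl) (hr : Fr ≤ Gr) :
      RingExtensionsAgree Fl Fr Gl Gr δ := ringExtensionsAgree_of_le (symFilter_mono hl hr) hδ
  have lambek {Fl : GabrielFilter R} {Fr : GabrielFilter Rᵐᵒᵖ} (hl : Fl.IsFaithful)
      (hr : Fr.IsFaithful) : ModuleExtensionsAgree Fl Fr (lambekFilter R) (lambekFilter Rᵐᵒᵖ) δ d :=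
    moduleExtensionsAgree_of_le (symFilter_mono hl.le_lambekFilter hr.le_lambekFilter) hδ hd
  refine ⟨Tl, Tr, hT, ⟨fun Fl Fr hl hr => agree hl.le_lambekFilter hr.le_lambekFilter,
      agree hT.left_faithful.le_lambekFilter hT.right_faithful.le_lambekFilter⟩,
    ⟨fun Fl Fr hl hr _ => lambek hl hr, lambek hT.left_faithful hT.right_faithful⟩,
    fun _ _ => ?_, agree (lambekFilter_le_goldieFilter R) (lambekFilter_le_goldieFilter Rᵐᵒᵖ),
    fun Fl Fr hl hr => agree hl.le_goldieFilter hr.le_goldieFilter⟩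
  have hCl := classicalFilter_isFaithful R
  have hCr := classicalFilter_isFaithful Rᵐᵒᵖ
  have hperf := isLeftFractionRing_numeratorRingHom.isPerfectSymRing
    (isLeftFractionRing_numeratorRingHom (A := R)).ringHom_op
  have hle := hT.largest _ _ ⟨_, _, _, hperf⟩ hCl hCr
  exact ⟨hperf.iso, agree hCl.le_lambekFilter hCr.le_lambekFilter, agree hle.1 hle.2⟩
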